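/- Let $\Gamma$ be a tropical curve, i.e. the $\infty$-metric space underlying a finite connected nonempty multigraph with edge lengths in $(0,\infty]$, where only leaf edges may have length $\infty$ (their leaf end is then a point at infinity, and the edge is a copy of $[0,\infty]$ with its usual compact topology). Let $D$ be a divisor on $\Gamma$ (a finite formal $\mathbb Z$-combination of points) and let $K$ be a finite subgroup of the isometry group of $\Gamma$ (the group of homeomorphisms of $\Gamma$ preserving the path $\infty$-metric). A rational function $f\neq-\infty$ on $\Gamma$ is a continuous function $f:\Gamma\to\mathbb R\cup\{\pm\infty\}$ that is piecewise linear with integer slopes and finitely many pieces and takes the values $\pm\infty$ only at points at infinity; $\mathrm{ord}_x(f)$ is the sum of its outgoing slopes along all half-edges at $x$ (at a point at infinity, the slope near that point in the direction away from it), and $\mathrm{div}(f)=\sum_x \mathrm{ord}_x(f)\,x$. Let $R(D)$ be the set of rational functions $f\ne-\infty$ with $D+\mathrm{div}(f)\ge 0$, and let $R(D)^K=\{f\in R(D) : f\circ\sigma=f \text{ for all }\sigma\in K\}$. An element $f\in R(D)^K$ is an extremal of $R(D)^K$ if, for all $g_1,g_2\in R(D)^K$, $f=\max\{g_1,g_2\}$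 (pointwise) implies $f=g_1$ or $f=g_2$. A subgraph of $\Gamma$ is a compact subset with finitely many connected components. It is proper if it is not equal to $\Gamma$, and $K$-invariant if every element of $K$ maps it onto itself. A subgraph $\Gamma_1$ can fire on an effective divisor $E$ if, for every boundary point $x$ of $\Gamma_1$, $E(x)$ is at least the number of half-edges at $x$ pointing out of $\Gamma_1$. Let $f\in R(D)^K$. Then $f$ is an extremal of $R(D)^K$ if and only if there do not exist two proper $K$-invariant subgraphs $\Gamma_1,\Gamma_2$ of $\Gamma$ with $\Gamma_1\cup\Gamma_2=\Gamma$ such that each of them can fire on $D+\mathrm{div}(f)$. -/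

import Mathlib

open Set Filter Topology
open scoped ENNReal

/-- An edge-weighted graph: a finite connected nonempty multigraph (loops allowed, each edge given an
orientation for the sake of parametrization) with a length function `len : E → (0, ∞]`. An edge of
infinite length is a leaf edge; it is oriented towards its end at infinity, which is a leaf end.
(The curve `[-∞, ∞]` is given by two edges of infinite length glued at the origin.) -/
structure EdgeWeightedGraph (V E : Type*) [Fintype V] [Fintype E] where
  src : E → V
  tgt : E → V
  nonempty : Nonempty V
  connected : ∀ u v : V, Relation.EqvGen (fun a b => ∃ e, src e = a ∧ tgt e = b) u v
  len : E → ℝ≥0∞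
  len_pos : ∀ e, 0 < len e
  leaf_of_len_eq_top : ∀ e, len e = ⊤ →
    Nat.card {e' // src e' = tgt e} + Nat.card {e' // tgt e' = tgt e} = 1

namespace EdgeWeightedGraph

variable {V E : Type*} [Fintype V] [Fintype E] (G : EdgeWeightedGraph V E)

/-- The points of the tropical curve `Γ` with model `G`: the vertices, and the points of the relative
interiors of the edges, an edge `e` being parametrized by `[0, len e]`. -/
inductive Curve (G : EdgeWeightedGraph V E) : Type _
  | vertex (v : V) : Curve G
  | inner (e : E) (t : ℝ≥0∞) (h0 : 0 < t) (h1 : t < G.len e) : Curve G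

open Classical in
/-- The point of the edge `e` with parameter `t ∈ [0, len e]`: parameter `0` is the vertex `src e`,
parameter `len e` is the vertex `tgt e` (parameters beyond `len e` are clamped to `len e`). -/
noncomputable def point (e : E) (t : ℝ≥0∞) : G.Curve :=
  if h0 : 0 < t then
    if h1 : t < G.len e then Curve.inner e t h0 h1 else Curve.vertex (G.tgt e)
  else Curve.vertex (G.src e)

/-- The gluing (quotient) topology: a set is open iff its preimage in every edge `[0, len e]` is open,
where `[0, ∞]` has its usual compact topology. -/
noncomputable instance : TopologicalSpace G.Curve :=
  ⨆ e : E, TopologicalSpace.coinduced (G.point e) inferInstance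

/-- `G.PathLength x y r`: there is a path from `x` to `y`, composed of finitely many segments each of
which runs inside one edge, of total length `r`. -/
inductive PathLength (x : G.Curve) : G.Curve → ℝ≥0∞ → Prop
  | refl : PathLength x x 0
  | step (y z : G.Curve) (r : ℝ≥0∞) (e : E) (s t : ℝ≥0∞) (hs : s ≤ G.len e) (ht : t ≤ G.len e)
      (hy : y = G.point e s) (hz : z = G.point e t) (h : PathLength x y r) :
      PathLength x z (r + ((s - t) + (t - s)))

/-- The path `∞`-metric on the tropical curve. -/
noncomputable def pathDist (x y : G.Curve) : ℝ≥0∞ := sInf {r | G.PathLength x y r}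

/-- The isometry group of the tropical curve: the homeomorphisms that preserve the `∞`-metric. -/
noncomputable def isometryGroup : Subgroup (G.Curve ≃ₜ G.Curve) where
  carrier := {σ | ∀ x y, G.pathDist (σ x) (σ y) = G.pathDist x y}
  one_mem' := fun _ _ => rfl
  mul_mem' := fun {a b} ha hb x y => (ha (b x) (b y)).trans (hb x y)
  inv_mem' := fun {a} ha x y => by
    have h := ha (a.symm x) (a.symm y)
    rw [a.apply_symm_apply, a.apply_symm_apply] at h
    exact h.symm

/-- The points at infinity: the infinite ends of the edges of infinite length. -/
def AtInfinity (x : G.Curve) : Prop := ∃ e, G.len e = ⊤ ∧ x = G.point e ⊤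

/-! ### Half-edges

A half-edge emanating from a point is encoded by a pair `(e, d)`: it runs along the edge `e`, in the
direction of increasing parameter if `d = true` and of decreasing parameter if `d = false`. A loop at
a vertex `v` thus gives two half-edges at `v`, and an inner point has exactly two half-edges. -/

/-- `h` is a half-edge emanating from `x`. -/
def IsHalfEdgeAt (x : G.Curve) (h : E × Bool) : Prop :=
  match x with
  | Curve.vertex v => if h.2 then G.src h.1 = v else G.tgt h.1 = v
  | Curve.inner e _ _ _ => h.1 = e

/-- The parameter of `x` on the edge of the half-edge `h`, seen as the starting point of `h`. -/
noncomputable def startParam (x : G.Curve) (h : E × Bool) : ℝ≥0∞ :=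
  match x with
  | Curve.vertex _ => if h.2 then 0 else G.len h.1
  | Curve.inner _ t _ _ => t

/-- The filter of parameters close to `x` (and different from it) on the half-edge `h` of `x`. -/
noncomputable def germ (x : G.Curve) (h : E × Bool) : Filter ℝ≥0∞ :=
  if h.2 then 𝓝[>] (G.startParam x h) else 𝓝[<] (G.startParam x h)

/-- Near `x`, `f` is affine along the half-edge `h` of `x`, with outgoing slope `s`. (This makes sense
for a point `x` at infinity, too, whatever the value of `f` at `x` is.) -/
def HasOutSlope (f : G.Curve → EReal) (x : G.Curve) (h : E × Bool) (s : ℤ) : Prop :=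
  ∃ c : ℝ, ∀ᶠ u in G.germ x h,
    f (G.point h.1 u) = ((c + (if h.2 then (s : ℝ) else -(s : ℝ)) * u.toReal : ℝ) : EReal)

open Classical in
/-- The outgoing slope of `f` at `x` along the half-edge `h` of `x`. -/
noncomputable def outSlope (f : G.Curve → EReal) (x : G.Curve) (h : E × Bool) : ℤ :=
  if hs : ∃ s, G.HasOutSlope f x h s then hs.choose else 0

open Classical in
/-- `ord_x(f)`: the sum of the outgoing slopes of `f` at `x`. -/
noncomputable def ord (f : G.Curve → EReal) (x : G.Curve) : ℤ :=
  ∑ h : E × Bool with G.IsHalfEdgeAt x h, G.outSlope f x h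

/-- The rational functions other than the constant function `-∞`: continuous functions that take the
values `±∞` only at points at infinity and that are piecewise affine with integer slopes and finitely
many pieces (for each edge, they are affine on the intervals avoiding a finite set of parameters). -/
structure IsPiecewiseLinear (f : G.Curve → EReal) : Prop where
  continuous : Continuous f
  finite_of_not_atInfinity : ∀ x, ¬ G.AtInfinity x → f x ≠ ⊥ ∧ f x ≠ ⊤
  piecewise : ∀ e : E, ∃ B : Finset ℝ≥0∞, ∀ a b : ℝ≥0∞, b ≤ G.len e → (∀ u ∈ B, u ∉ Ioo a b) →
    ∃ (n : ℤ) (c : ℝ), ∀ u ∈ Ioo a b, f (G.point e u) = ((c + n * u.toReal : ℝ) : EReal)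

/-- `Rat(Γ)`. -/
def Rat : Set (G.Curve → EReal) := {f | f = (fun _ => ⊥) ∨ G.IsPiecewiseLinear f}

variable {G}

theorem HasOutSlope.unique {f : G.Curve → EReal} {x : G.Curve} {h : E × Bool} {s s' : ℤ}
    (hx : (h.2 = true ∧ G.startParam x h ≠ ⊤) ∨ (h.2 = false ∧ G.startParam x h ≠ 0))
    (hs : G.HasOutSlope f x h s) (hs' : G.HasOutSlope f x h s') : s = s' := by
  obtain ⟨c, hc⟩ := hs
  obtain ⟨c', hc'⟩ := hs'
  obtain ⟨a, b, hab, hIoo⟩ : ∃ a b : ℝ≥0∞, a < b ∧ ∀ u ∈ Ioo a b,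
      (c + (if h.2 then (s : ℝ) else -(s : ℝ)) * u.toReal : ℝ) =
        c' + (if h.2 then (s' : ℝ) else -(s' : ℝ)) * u.toReal := by
    have hev := hc.and hc'
    rcases hx with ⟨hd, ht⟩ | ⟨hd, ht⟩
    · simp only [germ, hd, if_true] at hev
      obtain ⟨b, hb, hsub⟩ := (mem_nhdsGT_iff_exists_Ioo_subset' (lt_top_iff_ne_top.2 ht)).1 hev
      refine ⟨_, b, hb, fun u hu => ?_⟩
      have := hsub hu
      simp only [mem_ofPred_eq] at this
      simpa [hd] using EReal.coe_injective (this.1.symm.trans this.2)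
    · simp only [germ, hd, Bool.false_eq_true, if_false] at hev
      obtain ⟨a, ha, hsub⟩ := (mem_nhdsLT_iff_exists_Ioo_subset' (pos_iff_ne_zero.2 ht)).1 hev
      refine ⟨a, _, ha, fun u hu => ?_⟩
      have := hsub hu
      simp only [mem_ofPred_eq] at this
      simpa [hd] using EReal.coe_injective (this.1.symm.trans this.2)
  obtain ⟨u, hu⟩ := exists_between hab
  obtain ⟨w, hw⟩ := exists_between hu.2
  have h1 := hIoo u hu
  have h2 := hIoo w ⟨hu.1.trans hw.1, hw.2⟩
  have hlt : u.toReal < w.toReal := (ENNReal.toReal_lt_toReal hu.2.ne_top hw.2.ne_top).2 hw.1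
  have hss : ((s : ℝ) - s') * (w.toReal - u.toReal) = 0 := by
    split_ifs at h1 h2 <;> linarith
  rcases mul_eq_zero.1 hss with h | h
  · exact_mod_cast sub_eq_zero.1 h
  · linarith

theorem HasOutSlope.outSlope_eq {f : G.Curve → EReal} {x : G.Curve} {h : E × Bool} {s : ℤ}
    (hx : (h.2 = true ∧ G.startParam x h ≠ ⊤) ∨ (h.2 = false ∧ G.startParam x h ≠ 0))
    (hs : G.HasOutSlope f x h s) : G.outSlope f x h = s := by
  have hex : ∃ s, G.HasOutSlope f x h s := ⟨s, hs⟩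
  rw [outSlope, dif_pos hex]
  exact HasOutSlope.unique hx hex.choose_spec hs

/-- `ord_x(f)` vanishes at all but finitely many points. -/
theorem IsPiecewiseLinear.finite_support_ord {f : G.Curve → EReal} (hf : G.IsPiecewiseLinear f) :
    (Function.support (G.ord f)).Finite := by
  classical
  choose B hB using hf.piecewise
  refine ((Set.finite_range (Curve.vertex : V → G.Curve)).union
    (Set.finite_iUnion fun e : E => ((B e).finite_toSet.image (G.point e)))).subset ?_
  rintro (v | ⟨e, t, h0, h1⟩) hx
  · exact Or.inl ⟨v, rfl⟩
  · refine Or.inr (mem_iUnion.2 ⟨e, ?_⟩)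
    by_contra hcon
    have htB : t ∉ B e := fun ht => hcon ⟨t, ht, by simp [point, h0, h1]⟩
    apply hx
    have hopen : ((B e : Set ℝ≥0∞)ᶜ ∩ Iio (G.len e)) ∈ 𝓝 t :=
      inter_mem ((B e).finite_toSet.isClosed.isOpen_compl.mem_nhds htB) (Iio_mem_nhds h1)
    obtain ⟨a, b, ⟨hat, htb⟩, hsub⟩ :=
      (mem_nhds_iff_exists_Ioo_subset' ⟨0, h0⟩ ⟨⊤, h1.trans_le le_top⟩).1 hopen
    obtain ⟨n, c, hn⟩ := hB e a b
      (le_of_forall_lt fun u hu => by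
        rcases lt_or_ge t u with h | h
        · exact (hsub ⟨hat.trans h, hu⟩).2
        · exact h.trans_lt h1)
      (fun u hu hab => (hsub hab).1 hu)
    have hp : G.outSlope f (Curve.inner e t h0 h1) (e, true) = n := by
      refine HasOutSlope.outSlope_eq (Or.inl ⟨rfl, h1.ne_top⟩) ⟨c, ?_⟩
      simp only [germ, startParam, if_true]
      filter_upwards [Ioo_mem_nhdsGT htb] with u hu
      exact hn u ⟨hat.trans hu.1, hu.2⟩
    have hm : G.outSlope f (Curve.inner e t h0 h1) (e, false) = -n := by
      refine HasOutSlope.outSlope_eq (Or.inr ⟨rfl, h0.ne'⟩) ⟨c, ?_⟩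
      simp only [germ, startParam, Bool.false_eq_true, if_false]
      filter_upwards [Ioo_mem_nhdsLT hat] with u hu
      rw [hn u ⟨hu.1, hu.2.trans htb⟩]
      simp
    have hfil : (Finset.univ.filter fun h : E × Bool =>
        G.IsHalfEdgeAt (Curve.inner e t h0 h1) h) = {(e, true), (e, false)} := by
      ext ⟨e', d⟩
      have : G.IsHalfEdgeAt (Curve.inner e t h0 h1) (e', d) ↔ e' = e := Iff.rfl
      cases d <;> simp [this]
    rw [ord]
    convert (Finset.sum_congr hfil fun _ _ => rfl).trans (Finset.sum_pair (by simp)) using 1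
    · rw [hp, hm, add_neg_cancel]

variable (G)

/-- The principal divisor `div(f) = ∑ ord_x(f) · x` of a rational function `f ≠ -∞` (the case
distinction is harmless: the support is finite by `IsPiecewiseLinear.finite_support_ord`). -/
noncomputable def div (f : G.Curve → EReal) : G.Curve →₀ ℤ :=
  open Classical in
  if h : (Function.support (G.ord f)).Finite then Finsupp.ofSupportFinite (G.ord f) h else 0

theorem div_apply {f : G.Curve → EReal} (hf : G.IsPiecewiseLinear f) (x : G.Curve) :
    G.div f x = G.ord f x := by
  rw [div, dif_pos hf.finite_support_ord]
  rfl

/-- `R(D)`: the rational functions `f ≠ -∞` such that `D + div(f)` is effective. -/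
def R (D : G.Curve →₀ ℤ) : Set (G.Curve → EReal) :=
  {f | f ∈ G.Rat ∧ f ≠ (fun _ => ⊥) ∧ 0 ≤ D + G.div f}

/-- `R(D)^K`: the `K`-invariant elements of `R(D)`. -/
def RInv (D : G.Curve →₀ ℤ) (K : Subgroup (G.Curve ≃ₜ G.Curve)) : Set (G.Curve → EReal) :=
  {f | f ∈ G.R D ∧ ∀ σ ∈ K, f ∘ σ = f}

/-- `f` is an extremal of `M`; the tropical sum of functions is the pointwise maximum `⊔`. -/
def IsExtremal (M : Set (G.Curve → EReal)) (f : G.Curve → EReal) : Prop :=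
  f ∈ M ∧ ∀ g₁ ∈ M, ∀ g₂ ∈ M, f = g₁ ⊔ g₂ → f = g₁ ∨ f = g₂

/-- A subgraph: a compact subset with finitely many connected components. -/
def IsSubgraph (S : Set G.Curve) : Prop := IsCompact S ∧ Finite (ConnectedComponents S)

/-- `S` is `K`-invariant. -/
def IsInvariant (K : Subgroup (G.Curve ≃ₜ G.Curve)) (S : Set G.Curve) : Prop :=
  ∀ σ ∈ K, σ '' S = S

open Classical in
/-- The number of half-edges at `x` pointing out of `S`. -/
noncomputable def outDegree (S : Set G.Curve) (x : G.Curve) : ℕ :=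
  (Finset.univ.filter fun h : E × Bool =>
    G.IsHalfEdgeAt x h ∧ ∀ᶠ u in G.germ x h, G.point h.1 u ∉ S).card

/-- `S` can fire on the chip configuration `D`. -/
def CanFire (S : Set G.Curve) (D : G.Curve →₀ ℤ) : Prop :=
  ∀ x ∈ frontier S, (G.outDegree S x : ℤ) ≤ D x

end EdgeWeightedGraph

namespace EdgeWeightedGraph

variable {V E : Type*} [Fintype V] [Fintype E] {G : EdgeWeightedGraph V E}

/-! Decreasing `f` inside `R(D)^K` is the same as firing a subgraph, and `f = max g₁ g₂` says that
the loci `{f = g₁}` and `{f = g₂}` cover the curve.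

From functions to subgraphs: let `g ≤ f` with both in `R(D)^K`, and let `x` be a finite point with
`f x = g x`. Along every half-edge at `x` the slope of `g` is at most that of `f`. Along a half-edge
leaving `{f = g}` it is strictly smaller, hence smaller by at least one because slopes are integers.
So `ord g x` plus the out-degree is at most `ord f x` (`ord_add_outDegree_le`), and effectivity of
`D + div g` gives the firing condition for `D + div f` (`exists_canFire_of_le`).

From subgraphs to functions: if `S` can fire, subtract from `f` the collar function `min ε (dist(·,
S))`. It is `K`-invariant because `K` acts by isometries. Its order is at most the out-degree on `S`
(`IsCollarWidth.ord_le_outDegree`) and at most zero off `S`, where it is locally concave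
(`IsCollarWidth.ord_nonpos`). Hence the difference stays in `R(D)^K`, lies below `f` and differs
from it (`exists_lt_of_canFire`). Two such differences, for subgraphs covering the curve, have
maximum `f`.

Points at infinity obstruct both directions. Two functions may agree at such a point only because
both are infinite there, and then their slopes compare the wrong way. Likewise, the collar of a set
having such a point as an isolated point is discontinuous. Both problems disappear on replacing a
closed set `S` by its regular part `closure (interior S)`: it has the same out-degrees, no boundary
point at infinity (`IsTame.mem_interior_of_atInfinity`), and covers remain covers
(`closure_interior_union_eq_univ`).

The topology is handled through germs along half-edges. Subgraphs are exactly the closed tame sets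
(`IsSubgraph.isTame`, `IsTame.isSubgraph`), and piecewise linearity becomes a condition on germs
(`isPiecewiseLinear_of_exists_hasOutSlope`). -/

theorem point_zero (e : E) : G.point e 0 = Curve.vertex (G.src e) := by simp [point]

theorem point_of_len_le {e : E} {t : ℝ≥0∞} (h : G.len e ≤ t) :
    G.point e t = Curve.vertex (G.tgt e) := by
  simp [point, (G.len_pos e).trans_le h, h.not_gt]

theorem point_of_mem_Ioo {e : E} {t : ℝ≥0∞} (h0 : 0 < t) (h1 : t < G.len e) :
    G.point e t = Curve.inner e t h0 h1 := by
  simp [point, h0, h1]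

theorem point_eq_inner_iff {e e' : E} {t t' : ℝ≥0∞} {h0 : 0 < t'} {h1 : t' < G.len e'} :
    G.point e t = Curve.inner e' t' h0 h1 ↔ e = e' ∧ t = t' := by
  unfold point
  split_ifs with h2 h3
  · simp
  · simp only [false_iff]
    rintro ⟨rfl, rfl⟩
    exact h3 h1
  · simp only [false_iff]
    rintro ⟨rfl, rfl⟩
    exact h2 h0

theorem isOpen_iff_preimage {A : Set G.Curve} :
    IsOpen A ↔ ∀ e, IsOpen (G.point e ⁻¹' A) := by
  rw [isOpen_iSup_iff]
  rfl

theorem continuous_point (e : E) : Continuous (G.point e) :=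
  ⟨fun _ hA => isOpen_iff_preimage.1 hA e⟩

/-! ### Half-edges and neighbourhoods -/

section HalfEdge

variable {x : G.Curve} {h : E × Bool}

theorem point_startParam (hx : G.IsHalfEdgeAt x h) : G.point h.1 (G.startParam x h) = x := by
  obtain ⟨e, d⟩ := h
  cases x with
  | vertex v =>
    cases d
    · simp only [IsHalfEdgeAt, Bool.false_eq_true, if_false] at hx
      simp [startParam, point_of_len_le, hx]
    · simp only [IsHalfEdgeAt, if_true] at hx
      simp [startParam, point_zero, hx]
  | inner e' t h0 h1 =>
    obtain rfl : e = e' := hx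
    exact point_of_mem_Ioo h0 h1

theorem startParam_le_len (hx : G.IsHalfEdgeAt x h) : G.startParam x h ≤ G.len h.1 := by
  obtain ⟨e, d⟩ := h
  cases x with
  | vertex v => cases d <;> simp [startParam]
  | inner e' t h0 h1 =>
    obtain rfl : e = e' := hx
    exact h1.le

theorem startParam_lt_len {e : E} (hx : G.IsHalfEdgeAt x (e, true)) :
    G.startParam x (e, true) < G.len e := by
  cases x with
  | vertex v => simpa [startParam] using G.len_pos e
  | inner e' t h0 h1 =>
    obtain rfl : e = e' := hx
    exact h1

theorem startParam_pos {e : E} (hx : G.IsHalfEdgeAt x (e, false)) :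
    0 < G.startParam x (e, false) := by
  cases x with
  | vertex v => simpa [startParam] using G.len_pos e
  | inner e' t h0 h1 => exact h0

theorem germ_true {e : E} : G.germ x (e, true) = 𝓝[>] (G.startParam x (e, true)) := by
  simp [germ]

theorem germ_false {e : E} : G.germ x (e, false) = 𝓝[<] (G.startParam x (e, false)) := by
  simp [germ]

theorem startParam_ne (hx : G.IsHalfEdgeAt x h) :
    (h.2 = true ∧ G.startParam x h ≠ ⊤) ∨ (h.2 = false ∧ G.startParam x h ≠ 0) := by
  obtain ⟨e, d⟩ := h
  cases d
  · exact Or.inr ⟨rfl, (startParam_pos hx).ne'⟩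
  · exact Or.inl ⟨rfl, ((startParam_lt_len hx).trans_le le_top).ne⟩

theorem germ_neBot (hx : G.IsHalfEdgeAt x h) : (G.germ x h).NeBot := by
  obtain ⟨e, d⟩ := h
  cases d
  · rw [germ_false]
    exact nhdsLT_neBot_of_exists_lt ⟨0, startParam_pos hx⟩
  · rw [germ_true]
    exact nhdsGT_neBot_of_exists_gt ⟨_, startParam_lt_len hx⟩

theorem germ_le_nhdsNE (x : G.Curve) (h : E × Bool) : G.germ x h ≤ 𝓝[≠] (G.startParam x h) := by
  obtain ⟨e, d⟩ := h
  cases d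
  · rw [germ_false]
    exact nhdsWithin_mono _ fun _ h => ne_of_lt h
  · rw [germ_true]
    exact nhdsWithin_mono _ fun _ h => ne_of_gt h

theorem germ_le_nhds (x : G.Curve) (h : E × Bool) : G.germ x h ≤ 𝓝 (G.startParam x h) :=
  (germ_le_nhdsNE x h).trans nhdsWithin_le_nhds

theorem eventually_germ_mem_Ioo (hx : G.IsHalfEdgeAt x h) :
    ∀ᶠ u in G.germ x h, u ∈ Ioo 0 (G.len h.1) := by
  obtain ⟨e, d⟩ := h
  cases d
  · rw [germ_false]
    filter_upwards [Ioo_mem_nhdsLT (startParam_pos hx)] with u hu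
    exact ⟨hu.1, hu.2.trans_le (startParam_le_len hx)⟩
  · rw [germ_true]
    filter_upwards [Ioo_mem_nhdsGT (startParam_lt_len hx)] with u hu
    exact ⟨bot_le.trans_lt hu.1, hu.2⟩

theorem tendsto_point_germ (hx : G.IsHalfEdgeAt x h) :
    Tendsto (G.point h.1) (G.germ x h) (𝓝 x) := by
  have := ((continuous_point (G := G) h.1).tendsto (G.startParam x h)).mono_left (germ_le_nhds x h)
  rwa [point_startParam hx] at this

theorem eventually_eventually_germ {p : ℝ≥0∞ → Prop} (hp : ∀ᶠ u in G.germ x h, p u) :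
    ∀ᶠ u in G.germ x h, ∀ᶠ w in 𝓝 u, p w := by
  obtain ⟨e, d⟩ := h
  cases d
  · rw [germ_false] at hp ⊢
    filter_upwards [eventually_eventually_nhdsWithin.2 hp, self_mem_nhdsWithin] with u hu hlt
    rwa [isOpen_Iio.nhdsWithin_eq hlt] at hu
  · rw [germ_true] at hp ⊢
    filter_upwards [eventually_eventually_nhdsWithin.2 hp, self_mem_nhdsWithin] with u hu hlt
    rwa [isOpen_Ioi.nhdsWithin_eq hlt] at hu

end HalfEdge

theorem isHalfEdgeAt_point_true {e : E} {t : ℝ≥0∞} (ht : t < G.len e) :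
    G.IsHalfEdgeAt (G.point e t) (e, true) ∧ G.startParam (G.point e t) (e, true) = t := by
  rcases eq_zero_or_pos t with rfl | h0
  · rw [point_zero]
    simp [IsHalfEdgeAt, startParam]
  · rw [point_of_mem_Ioo h0 ht]
    exact ⟨rfl, rfl⟩

theorem isHalfEdgeAt_point_false {e : E} {t : ℝ≥0∞} (h0 : 0 < t) (ht : t ≤ G.len e) :
    G.IsHalfEdgeAt (G.point e t) (e, false) ∧ G.startParam (G.point e t) (e, false) = t := by
  rcases ht.eq_or_lt with rfl | ht
  · rw [point_of_len_le le_rfl]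
    simp [IsHalfEdgeAt, startParam]
  · rw [point_of_mem_Ioo h0 ht]
    exact ⟨rfl, rfl⟩

/-- A set is open iff it contains an initial piece of each half-edge at each of its points. -/
theorem isOpen_iff_germ {A : Set G.Curve} :
    IsOpen A ↔ ∀ x ∈ A, ∀ h, G.IsHalfEdgeAt x h → ∀ᶠ u in G.germ x h, G.point h.1 u ∈ A := by
  refine ⟨fun hA x hx h hh => tendsto_point_germ hh (hA.mem_nhds hx), fun H => ?_⟩
  refine isOpen_iff_preimage.2 fun e => isOpen_iff_mem_nhds.2 fun t ht => ?_
  have hleft : t ≤ G.len e → ∀ᶠ u in 𝓝[<] t, u ∈ G.point e ⁻¹' A := fun hle => by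
    rcases eq_zero_or_pos t with rfl | h0
    · simp
    · obtain ⟨h1, h2⟩ := isHalfEdgeAt_point_false h0 hle
      have := H _ ht _ h1
      rwa [germ_false, h2] at this
  rcases lt_or_ge t (G.len e) with hlt | hge
  · have hright : ∀ᶠ u in 𝓝[>] t, u ∈ G.point e ⁻¹' A := by
      obtain ⟨h1, h2⟩ := isHalfEdgeAt_point_true hlt
      have := H _ ht _ h1
      rwa [germ_true, h2] at this
    rw [← nhdsLT_sup_nhdsGE, ← nhdsGT_sup_nhdsWithin_singleton]
    simp only [nhdsWithin_singleton, mem_sup]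
    exact ⟨hleft hlt.le, hright, ht⟩
  -- Parameters beyond `len e` are clamped, so `G.point e` is constant there and no half-edge
  -- condition is needed on that side.
  · have hconst : ∀ u, G.len e ≤ u → u ∈ G.point e ⁻¹' A := fun u hu => by
      rw [mem_preimage, point_of_len_le hge] at ht
      rwa [mem_preimage, point_of_len_le hu]
    rcases hge.eq_or_lt with rfl | hgt
    · rw [← nhdsLT_sup_nhdsGE]
      exact mem_sup.2 ⟨hleft le_rfl, mem_of_superset self_mem_nhdsWithin hconst⟩
    · exact mem_of_superset (Ioi_mem_nhds hgt) fun u hu => hconst u (le_of_lt hu)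

/-- The points of `A` all of whose germs lie in `A` form an open set: on a half-edge, the nearby
points are inner points, and both of their germs lie in the same piece of edge. -/
theorem mem_nhds_iff_germ {A : Set G.Curve} {x : G.Curve} :
    A ∈ 𝓝 x ↔ x ∈ A ∧ ∀ h, G.IsHalfEdgeAt x h → ∀ᶠ u in G.germ x h, G.point h.1 u ∈ A := by
  refine ⟨fun hA => ⟨mem_of_mem_nhds hA, fun h hh => tendsto_point_germ hh hA⟩, fun H => ?_⟩
  refine mem_of_superset (IsOpen.mem_nhds (s := {y | y ∈ A ∧ ∀ h, G.IsHalfEdgeAt y h →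
    ∀ᶠ u in G.germ y h, G.point h.1 u ∈ A}) (isOpen_iff_germ.2 ?_) H) fun y hy => hy.1
  rintro y ⟨-, hy⟩ h hh
  filter_upwards [hy h hh, eventually_eventually_germ (hy h hh), eventually_germ_mem_Ioo hh]
    with u hu hu' hu''
  refine ⟨hu, ?_⟩
  rw [point_of_mem_Ioo hu''.1 hu''.2]
  rintro ⟨e, d⟩ hd
  obtain rfl : e = h.1 := hd
  exact germ_le_nhds _ _ hu'

theorem continuousAt_iff_germ {Y : Type*} [TopologicalSpace Y] {F : G.Curve → Y} {x : G.Curve} :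
    ContinuousAt F x ↔ ∀ h, G.IsHalfEdgeAt x h →
      Tendsto (fun u => F (G.point h.1 u)) (G.germ x h) (𝓝 (F x)) := by
  refine ⟨fun hF h hh => hF.tendsto.comp (tendsto_point_germ hh), fun H A hA => ?_⟩
  exact mem_nhds_iff_germ.2 ⟨mem_preimage.2 (mem_of_mem_nhds hA), fun h hh => H h hh hA⟩

/-! ### The curve is compact and Hausdorff -/

instance : CompactSpace G.Curve := by
  have : (univ : Set G.Curve) = range Curve.vertex ∪ ⋃ e, range (G.point e) := by
    refine (eq_univ_of_forall ?_).symm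
    rintro (v | ⟨e, t, h0, h1⟩)
    · exact Or.inl ⟨v, rfl⟩
    · exact Or.inr (mem_iUnion.2 ⟨e, t, point_of_mem_Ioo h0 h1⟩)
  refine ⟨this ▸ (finite_range _).isCompact.union (isCompact_iUnion fun e => ?_)⟩
  exact isCompact_range (continuous_point e)

/-- The image of an open interval inside an edge is open. -/
theorem isOpen_point_image {e : E} {U : Set ℝ≥0∞} (hU : IsOpen U) (hs : U ⊆ Ioo 0 (G.len e)) :
    IsOpen (G.point e '' U) := by
  refine isOpen_iff_germ.2 ?_
  rintro _ ⟨u, hu, rfl⟩ ⟨e', d⟩ hh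
  rw [point_of_mem_Ioo (hs hu).1 (hs hu).2] at hh ⊢
  obtain rfl : e' = e := hh
  exact germ_le_nhds _ _ (mem_of_superset (hU.mem_nhds hu) fun w hw => ⟨w, hw, rfl⟩)

theorem isClosed_point_image {e : E} {U : Set ℝ≥0∞} (hU : IsClosed U) (hs : U ⊆ Ioo 0 (G.len e)) :
    IsClosed (G.point e '' U) := by
  refine ⟨isOpen_iff_preimage.2 fun e' => ?_⟩
  rw [preimage_compl, isOpen_compl_iff]
  by_cases he : e' = e
  · subst he
    convert hU
    ext t
    refine ⟨?_, fun ht => ⟨t, ht, rfl⟩⟩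
    rintro ⟨u, hu, hut⟩
    rw [point_of_mem_Ioo (hs hu).1 (hs hu).2, eq_comm, point_eq_inner_iff] at hut
    rwa [hut.2]
  · convert isClosed_empty
    refine eq_empty_of_forall_notMem ?_
    rintro t ⟨u, hu, hut⟩
    rw [point_of_mem_Ioo (hs hu).1 (hs hu).2, eq_comm, point_eq_inner_iff] at hut
    exact he hut.1

theorem exists_Icc_subset_of_mem_Ioo {e : E} {t : ℝ≥0∞} {U : Set ℝ≥0∞} (hU : U ∈ 𝓝 t)
    (h0 : 0 < t) (h1 : t < G.len e) :
    ∃ a b, t ∈ Ioo a b ∧ Icc a b ⊆ U ∧ Icc a b ⊆ Ioo 0 (G.len e) := by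
  obtain ⟨a, b, ⟨hat, htb⟩, hsub⟩ := (mem_nhds_iff_exists_Ioo_subset' ⟨0, h0⟩ ⟨_, h1⟩).1
    (inter_mem hU (Ioo_mem_nhds h0 h1))
  obtain ⟨a', ha⟩ := exists_between hat
  obtain ⟨b', hb⟩ := exists_between htb
  exact ⟨a', b', ⟨ha.2, hb.1⟩, fun u hu => (hsub ⟨ha.1.trans_le hu.1, hu.2.trans_lt hb.2⟩).1,
    fun u hu => (hsub ⟨ha.1.trans_le hu.1, hu.2.trans_lt hb.2⟩).2⟩

instance : T2Space G.Curve := by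
  have hsep : ∀ (e : E) (t : ℝ≥0∞) (h0 : 0 < t) (h1 : t < G.len e) (y : G.Curve),
      y ≠ Curve.inner e t h0 h1 → Disjoint (𝓝 (Curve.inner e t h0 h1 : G.Curve)) (𝓝 y) := by
    intro e t h0 h1 y hy
    obtain ⟨U, hU, hyU⟩ : ∃ U ∈ 𝓝 t, y ∉ G.point e '' U := by
      rcases y with v | ⟨e', t', h0', h1'⟩
      · refine ⟨Ioo 0 (G.len e), Ioo_mem_nhds h0 h1, ?_⟩
        rintro ⟨u, hu, huv⟩
        rw [point_of_mem_Ioo hu.1 hu.2] at huv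
        simp at huv
      · refine ⟨{u | e = e' → u ≠ t'}, ?_, ?_⟩
        · by_cases he : e = e'
          · subst he
            simpa using isOpen_ne.mem_nhds fun ht : t = t' => hy (by subst ht; rfl)
          · simp [he]
        · rintro ⟨u, hu, huv⟩
          rw [point_eq_inner_iff] at huv
          exact hu huv.1 huv.2
    obtain ⟨a, b, htab, hab, hab'⟩ := exists_Icc_subset_of_mem_Ioo hU h0 h1
    rw [Filter.disjoint_iff]
    refine ⟨G.point e '' Icc a b, ?_, (G.point e '' Icc a b)ᶜ, ?_, disjoint_compl_right⟩
    · refine mem_of_superset ((isOpen_point_image isOpen_Ioo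
        (Ioo_subset_Icc_self.trans hab')).mem_nhds ⟨t, htab, point_of_mem_Ioo h0 h1⟩)
        (image_mono Ioo_subset_Icc_self)
    · exact (isClosed_point_image isClosed_Icc hab').isOpen_compl.mem_nhds
        fun hmem => hyU (image_mono hab hmem)
  refine t2Space_iff_disjoint_nhds.2 fun x y hxy => ?_
  rcases x with v | ⟨e, t, h0, h1⟩
  · rcases y with w | ⟨e, t, h0, h1⟩
    -- Cutting every edge at an intermediate parameter gives disjoint stars around distinct
    -- vertices, loops and multiple edges included.
    · choose m hm using fun e => exists_between (G.len_pos e)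
      let A : V → Set G.Curve := fun v => {x | x = Curve.vertex v ∨ ∃ e u, x = G.point e u ∧
        u ∈ Ioo 0 (G.len e) ∧ ((G.src e = v ∧ u < m e) ∨ (G.tgt e = v ∧ m e < u))}
      have hA : ∀ v, A v ∈ 𝓝 (Curve.vertex v) := by
        refine fun v => mem_nhds_iff_germ.2 ⟨Or.inl rfl, ?_⟩
        rintro ⟨e, d⟩ hh
        cases d
        · filter_upwards [eventually_germ_mem_Ioo hh, germ_le_nhds _ _ (Ioi_mem_nhds (hm e).2)]
            with u hu hu'
          exact Or.inr ⟨e, u, rfl, hu, Or.inr ⟨by simpa [IsHalfEdgeAt] using hh, hu'⟩⟩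
        · filter_upwards [eventually_germ_mem_Ioo hh, germ_le_nhds _ _ (Iio_mem_nhds (hm e).1)]
            with u hu hu'
          exact Or.inr ⟨e, u, rfl, hu, Or.inl ⟨by simpa [IsHalfEdgeAt] using hh, hu'⟩⟩
      refine Filter.disjoint_iff.2 ⟨A v, hA v, A w, hA w, Set.disjoint_left.2 ?_⟩
      have hvw : v ≠ w := fun h => hxy (by rw [h])
      rintro x (rfl | ⟨e, u, rfl, hu, hu'⟩) (hx | ⟨e', u', hx, hw, hw'⟩)
      · exact hxy hx
      · rw [point_of_mem_Ioo hw.1 hw.2] at hx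
        simp at hx
      · rw [point_of_mem_Ioo hu.1 hu.2] at hx
        simp at hx
      · rw [point_of_mem_Ioo hw.1 hw.2, point_eq_inner_iff] at hx
        obtain ⟨rfl, rfl⟩ := hx
        rcases hu' with ⟨h1, h2⟩ | ⟨h1, h2⟩ <;> rcases hw' with ⟨h3, h4⟩ | ⟨h3, h4⟩
        · exact hvw (h1.symm.trans h3)
        · exact h2.not_gt h4
        · exact h2.not_gt h4
        · exact hvw (h1.symm.trans h3)
    · exact (hsep e t h0 h1 _ hxy).symm
  · exact hsep e t h0 h1 y hxy.symm

/-! ### Tame sets -/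

/-- Along each half-edge, points close to the starting point are all in `S` or all outside `S`. -/
def IsTame (S : Set G.Curve) : Prop :=
  ∀ x h, G.IsHalfEdgeAt x h →
    (∀ᶠ u in G.germ x h, G.point h.1 u ∈ S) ∨ (∀ᶠ u in G.germ x h, G.point h.1 u ∉ S)

/-- Removing the two points with parameters `a` and `b` disconnects the open segment between them
from the rest of the curve. -/
theorem _root_.IsPreconnected.subset_point_image_Ioo {C : Set G.Curve} (hC : IsPreconnected C)
    {e : E} {a b u : ℝ≥0∞} (h0 : 0 < a) (hb : b < G.len e) (hu : u ∈ Ioo a b)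
    (haC : G.point e a ∉ C) (hbC : G.point e b ∉ C) (huC : G.point e u ∈ C) :
    C ⊆ G.point e '' Ioo a b := by
  have hsub : Icc a b ⊆ Ioo 0 (G.len e) := fun w hw => ⟨h0.trans_le hw.1, hw.2.trans_lt hb⟩
  refine hC.subset_left_of_subset_union (v := (G.point e '' Icc a b)ᶜ)
    (isOpen_point_image isOpen_Ioo (Ioo_subset_Icc_self.trans hsub))
    (isClosed_point_image isClosed_Icc hsub).isOpen_compl
    (disjoint_compl_right.mono_left (image_mono Ioo_subset_Icc_self)) ?_ ⟨_, huC, u, hu, rfl⟩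
  intro x hx
  by_cases hx' : x ∈ G.point e '' Icc a b
  · obtain ⟨w, hw, rfl⟩ := hx'
    refine Or.inl ⟨w, ⟨lt_of_le_of_ne hw.1 ?_, lt_of_le_of_ne hw.2 ?_⟩, rfl⟩
    · rintro rfl
      exact haC hx
    · rintro rfl
      exact hbC hx
  · exact Or.inr hx'

/-- If membership in `C` oscillated along a germ, four successive points would lie alternately
outside and inside `C`. The two outside points would confine `C` to the segment between them, which
excludes the fourth point. -/
theorem _root_.IsPreconnected.isTame {C : Set G.Curve} (hC : IsPreconnected C) : IsTame C := by
  rintro x ⟨e, d⟩ hh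
  by_contra! hcon
  obtain ⟨hin, hout⟩ := hcon
  have hinj : ∀ {a b u : ℝ≥0∞}, 0 < a → b < G.len e → G.point e u ∈ G.point e '' Ioo a b →
      u ∈ Ioo a b := by
    rintro a b u ha hb ⟨w, hw, hwu⟩
    rw [point_of_mem_Ioo (ha.trans hw.1) (hw.2.trans hb), eq_comm, point_eq_inner_iff] at hwu
    rwa [hwu.2]
  cases d
  · have hpos := startParam_pos hh
    have hle := startParam_le_len hh
    rw [germ_false] at hin hout
    obtain ⟨a, ha, haI⟩ := (hin.and_eventually (Ioo_mem_nhdsLT hpos)).exists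
    obtain ⟨u, hu, huI⟩ := (hout.and_eventually (Ioo_mem_nhdsLT haI.2)).exists
    obtain ⟨b, hb, hbI⟩ := (hin.and_eventually (Ioo_mem_nhdsLT huI.2)).exists
    obtain ⟨w, hw, hwI⟩ := (hout.and_eventually (Ioo_mem_nhdsLT hbI.2)).exists
    have := hC.subset_point_image_Ioo haI.1 (hbI.2.trans_le hle) ⟨huI.1, hbI.1⟩ ha hb hu hw
    exact (hinj haI.1 (hbI.2.trans_le hle) this).2.not_gt hwI.1
  · have hlt := startParam_lt_len hh
    rw [germ_true] at hin hout
    obtain ⟨b, hb, hbI⟩ := (hin.and_eventually (Ioo_mem_nhdsGT hlt)).exists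
    obtain ⟨u, hu, huI⟩ := (hout.and_eventually (Ioo_mem_nhdsGT hbI.1)).exists
    obtain ⟨a, ha, haI⟩ := (hin.and_eventually (Ioo_mem_nhdsGT huI.1)).exists
    obtain ⟨w, hw, hwI⟩ := (hout.and_eventually (Ioo_mem_nhdsGT haI.1)).exists
    have ha0 := bot_le.trans_lt haI.1
    have := hC.subset_point_image_Ioo ha0 hbI.2 ⟨haI.2, huI.2⟩ ha hb hu hw
    exact (hinj ha0 hbI.2 this).1.not_gt hwI.2

/-- Each component is tame, and there are only finitely many: either one of them contains the germ,
or the germ eventually avoids them all at once. -/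
theorem IsSubgraph.isTame {S : Set G.Curve} (hS : G.IsSubgraph S) : IsTame S := by
  have := hS.2
  have hpre : ∀ c : ConnectedComponents S,
      IsPreconnected ((↑) '' ((↑) ⁻¹' {c} : Set S) : Set G.Curve) := by
    intro c
    obtain ⟨x, rfl⟩ := ConnectedComponents.surjective_coe c
    rw [connectedComponents_preimage_singleton]
    exact isPreconnected_connectedComponent.image _ continuous_subtype_val.continuousOn
  intro x h hh
  by_cases hex : ∃ c : ConnectedComponents S, ∀ᶠ u in G.germ x h,
      G.point h.1 u ∈ ((↑) '' ((↑) ⁻¹' {c} : Set S) : Set G.Curve)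
  · obtain ⟨c, hc⟩ := hex
    refine Or.inl (hc.mono ?_)
    rintro u ⟨y, -, hy⟩
    exact hy ▸ y.2
  · rw [not_exists] at hex
    have hall := eventually_all.2 fun c => (hpre c).isTame x h hh |>.resolve_left (hex c)
    refine Or.inr (hall.mono fun u hu huS => hu _ ⟨⟨_, huS⟩, rfl, rfl⟩)

/-- Tameness makes every connected component of `S` relatively open, so the space of components is
discrete as well as compact. -/
theorem IsTame.isSubgraph {S : Set G.Curve} (hS : IsTame S) (hcl : IsClosed S) :
    G.IsSubgraph S := by
  refine ⟨hcl.isCompact, ?_⟩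
  have := isCompact_iff_compactSpace.1 hcl.isCompact
  suffices H : ∀ x : S, connectedComponent x ∈ 𝓝 x by
    have : DiscreteTopology (ConnectedComponents S) := by
      refine discreteTopology_iff_isOpen_singleton.2 fun c => ?_
      obtain ⟨x, rfl⟩ := ConnectedComponents.surjective_coe c
      rw [← ConnectedComponents.isQuotientMap_coe.isOpen_preimage,
        connectedComponents_preimage_singleton]
      refine isOpen_iff_mem_nhds.2 fun y hy => ?_
      rw [connectedComponent_eq hy]
      exact H y
    exact finite_of_compact_of_discrete
  rintro ⟨x, hx⟩
  rw [nhds_subtype_eq_comap]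
  refine ⟨{y | ∀ hy : y ∈ S, (⟨y, hy⟩ : S) ∈ connectedComponent (⟨x, hx⟩ : S)}, ?_,
    fun y hy => hy y.2⟩
  have key : ∀ P : Set G.Curve, IsPreconnected P → P ⊆ S → x ∈ P → ∀ y ∈ P, ∀ hy : y ∈ S,
      (⟨y, hy⟩ : S) ∈ connectedComponent (⟨x, hx⟩ : S) := by
    intro P hP hPS hxP y hyP hy
    have : IsPreconnected ((↑) ⁻¹' P : Set S) :=
      Topology.IsInducing.subtypeVal.isPreconnected_image.1 (by
        rwa [Subtype.image_preimage_coe, inter_eq_right.2 hPS])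
    exact this.subset_connectedComponent hxP hyP
  refine mem_nhds_iff_germ.2 ⟨fun _ => mem_connectedComponent, ?_⟩
  rintro ⟨e, d⟩ hh
  rcases hS x _ hh with hin | hout
  · have hx' := point_startParam hh
    cases d
    · have hpos := startParam_pos hh
      rw [germ_false] at hin ⊢
      obtain ⟨a, ha, hsub⟩ := (mem_nhdsLT_iff_exists_Ioo_subset' hpos).1 hin
      filter_upwards [Ioo_mem_nhdsLT ha] with u hu
      refine key (G.point e '' Ioc a (G.startParam x (e, false)))
        (isPreconnected_Ioc.image _ (continuous_point e).continuousOn) ?_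
        ⟨_, right_mem_Ioc.2 ha, hx'⟩ _ ⟨u, Ioo_subset_Ioc_self hu, rfl⟩
      rintro _ ⟨w, hw, rfl⟩
      rcases hw.2.eq_or_lt with heq | hlt
      · rw [heq]
        exact hx'.symm ▸ hx
      · exact hsub ⟨hw.1, hlt⟩
    · have hlt := startParam_lt_len hh
      rw [germ_true] at hin ⊢
      obtain ⟨a, ha, hsub⟩ := (mem_nhdsGT_iff_exists_Ioo_subset' hlt).1 hin
      filter_upwards [Ioo_mem_nhdsGT ha] with u hu
      refine key (G.point e '' Ico (G.startParam x (e, true)) a)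
        (isPreconnected_Ico.image _ (continuous_point e).continuousOn) ?_
        ⟨_, left_mem_Ico.2 ha, hx'⟩ _ ⟨u, Ioo_subset_Ico_self hu, rfl⟩
      rintro _ ⟨w, hw, rfl⟩
      rcases hw.1.eq_or_lt with heq | hlt
      · rw [← heq]
        exact hx'.symm ▸ hx
      · exact hsub ⟨hlt, hw.2⟩
  · exact hout.mono fun u hu hu' => absurd hu' hu

theorem AtInfinity.exists_halfEdge {x : G.Curve} (hx : G.AtInfinity x) :
    ∃ e, G.len e = ⊤ ∧ x = Curve.vertex (G.tgt e) ∧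
      ∀ h, G.IsHalfEdgeAt x h → h = (e, false) := by
  obtain ⟨e, he, rfl⟩ := hx
  rw [point_of_len_le le_top]
  refine ⟨e, he, rfl, ?_⟩
  have hcard := G.leaf_of_len_eq_top e he
  have hpos : 0 < Nat.card {e' // G.tgt e' = G.tgt e} :=
    Nat.card_pos_iff.2 ⟨⟨⟨e, rfl⟩⟩, inferInstance⟩
  have h1 : Nat.card {e' // G.tgt e' = G.tgt e} = 1 := by omega
  have h0 : Nat.card {e' // G.src e' = G.tgt e} = 0 := by omega
  rw [Nat.card_eq_zero, or_iff_left (fun h => h.not_finite inferInstance)] at h0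
  have := (Nat.card_eq_one_iff_unique.1 h1).1
  rintro ⟨e', d⟩ hh
  cases d
  · have hh : G.tgt e' = G.tgt e := by simpa [IsHalfEdgeAt] using hh
    have := congrArg Subtype.val (Subsingleton.elim (⟨e', hh⟩ : {e' // G.tgt e' = G.tgt e}) ⟨e, rfl⟩)
    simpa using this
  · exact (h0.false ⟨e', by simpa [IsHalfEdgeAt] using hh⟩).elim

/-! ### The regular part of a closed set -/

/-- The union of the two interiors is dense. An open set missing both interiors has its part off `B`
inside the interior of `A`, so it lies in `B`, hence in the interior of `B`, and is empty. -/
theorem _root_.closure_interior_union_eq_univ {X : Type*} [TopologicalSpace X] {A B : Set X}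
    (hB : IsClosed B) (h : A ∪ B = univ) :
    closure (interior A) ∪ closure (interior B) = univ := by
  rw [← closure_union, ← dense_iff_closure_eq, ← compl_compl (interior A ∪ interior B),
    ← interior_eq_empty_iff_dense_compl, compl_union]
  have h1 : interior ((interior A)ᶜ ∩ (interior B)ᶜ) ⊆ B := by
    intro x hx
    by_contra hxB
    have : interior ((interior A)ᶜ ∩ (interior B)ᶜ) ∩ Bᶜ ⊆ interior A :=
      interior_maximal (fun y hy => (h.symm.subset (mem_univ y)).resolve_right hy.2)
        (isOpen_interior.inter hB.isOpen_compl)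
    exact (interior_subset hx).1 (this ⟨hx, hxB⟩)
  have h2 := interior_maximal h1 isOpen_interior
  exact eq_empty_of_forall_notMem fun x hx => (interior_subset hx).2 (h2 hx)

section Regular

variable {S : Set G.Curve}

theorem _root_.IsClosed.closure_interior_subset' {X : Type*} [TopologicalSpace X] {S : Set X}
    (hS : IsClosed S) : closure (interior S) ⊆ S :=
  hS.closure_subset_iff.2 interior_subset

theorem eventually_germ_mem_interior {x : G.Curve} {h : E × Bool} (hh : G.IsHalfEdgeAt x h)
    (hin : ∀ᶠ u in G.germ x h, G.point h.1 u ∈ S) :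
    ∀ᶠ u in G.germ x h, G.point h.1 u ∈ interior S := by
  filter_upwards [hin, eventually_eventually_germ hin, eventually_germ_mem_Ioo hh] with u h1 h2 h3
  refine mem_interior_iff_mem_nhds.2 (mem_nhds_iff_germ.2 ⟨h1, ?_⟩)
  rw [point_of_mem_Ioo h3.1 h3.2]
  rintro ⟨e, d⟩ he
  obtain rfl : e = h.1 := he
  exact germ_le_nhds _ _ h2

/-- Only isolated points of `S` are lost in the regular part, and germs do not see them because they
exclude their starting point. -/
theorem IsTame.eventually_closure_interior_iff (hS : IsTame S) (hcl : IsClosed S) {x : G.Curve}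
    {h : E × Bool} (hh : G.IsHalfEdgeAt x h) :
    ∀ᶠ u in G.germ x h, (G.point h.1 u ∈ closure (interior S) ↔ G.point h.1 u ∈ S) := by
  rcases hS x h hh with hin | hout
  · filter_upwards [eventually_germ_mem_interior hh hin] with u hu
    exact ⟨fun h => hcl.closure_interior_subset' h, fun _ => subset_closure hu⟩
  · filter_upwards [hout] with u hu
    exact ⟨fun h => hcl.closure_interior_subset' h, fun h => absurd h hu⟩

theorem IsTame.closure_interior (hS : IsTame S) (hcl : IsClosed S) :
    IsTame (closure (interior S)) := by
  intro x h hh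
  have := hS.eventually_closure_interior_iff hcl hh
  exact (hS x h hh).imp (fun H => by filter_upwards [H, this] with u h1 h2 using h2.2 h1)
    (fun H => by filter_upwards [H, this] with u h1 h2 using fun h3 => h1 (h2.1 h3))

theorem IsTame.outDegree_closure_interior (hS : IsTame S) (hcl : IsClosed S) (x : G.Curve) :
    G.outDegree (closure (interior S)) x = G.outDegree S x := by
  unfold outDegree
  refine congrArg Finset.card (Finset.ext fun h => ?_)
  simp only [Finset.mem_filter, Finset.mem_univ, true_and]
  refine and_congr_right fun hh => ?_
  refine eventually_congr ((hS.eventually_closure_interior_iff hcl hh).mono fun u hu => ?_)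
  rw [hu]

theorem _root_.frontier_closure_interior_subset {X : Type*} [TopologicalSpace X] {S : Set X}
    (hcl : IsClosed S) : frontier (closure (interior S)) ⊆ frontier S := by
  rw [isClosed_closure.frontier_eq, hcl.frontier_eq]
  exact sdiff_subset_sdiff hcl.closure_interior_subset'
    (interior_maximal subset_closure isOpen_interior)

theorem IsTame.canFire_closure_interior (hS : IsTame S) (hcl : IsClosed S) {D : G.Curve →₀ ℤ}
    (hD : G.CanFire S D) : G.CanFire (closure (interior S)) D := fun x hx => by
  rw [hS.outDegree_closure_interior hcl]
  exact hD x (frontier_closure_interior_subset hcl hx)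

theorem IsInvariant.closure_interior {K : Subgroup (G.Curve ≃ₜ G.Curve)}
    (hS : G.IsInvariant K S) : G.IsInvariant K (closure (interior S)) := fun σ hσ => by
  rw [σ.image_closure, σ.image_interior, hS σ hσ]

/-- A regular closed set contains a whole neighbourhood of each of its points at infinity. -/
theorem IsTame.mem_interior_of_atInfinity (hS : IsTame S) (hcl : IsClosed S)
    {x : G.Curve} (hx : x ∈ closure (interior S)) (hinf : G.AtInfinity x) : x ∈ interior S := by
  obtain ⟨e, -, -, he⟩ := hinf.exists_halfEdge
  have hxS : x ∈ S := hcl.closure_interior_subset' hx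
  rw [mem_interior_iff_mem_nhds, mem_nhds_iff_germ]
  refine ⟨hxS, fun h hh => (hS x h hh).resolve_right fun hout => ?_⟩
  -- The single half-edge at `x` leaves `S`, so `x` would be isolated in `S`; this contradicts `x`
  -- being a limit of interior points.
  have hN : insert x Sᶜ ∈ 𝓝 x := mem_nhds_iff_germ.2 ⟨mem_insert _ _, fun h' hh' => by
    rw [he h' hh', ← he h hh]
    exact hout.mono fun u hu => Or.inr hu⟩
  obtain ⟨y, rfl | hy, hyS⟩ := mem_closure_iff_nhds.1 hx _ hN
  · have := germ_neBot hh
    obtain ⟨u, hu, hu'⟩ := (hout.and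
      (tendsto_point_germ hh (mem_interior_iff_mem_nhds.1 hyS))).exists
    exact hu hu'
  · exact hy (interior_subset hyS)

end Regular

/-! ### Affine functions along half-edges -/

section Germ

variable {x : G.Curve} {h : E × Bool}

theorem eventually_germ_lt_or_gt (hh : G.IsHalfEdgeAt x h) (τ : ℝ) :
    (∀ᶠ u in G.germ x h, u.toReal < τ) ∨ (∀ᶠ u in G.germ x h, τ < u.toReal) := by
  have hI := eventually_germ_mem_Ioo hh
  rcases lt_or_ge τ 0 with hτ | hτ
  · exact Or.inr (Eventually.of_forall fun u => hτ.trans_le ENNReal.toReal_nonneg)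
  have hlt : (∀ᶠ u in G.germ x h, u < ENNReal.ofReal τ) →
      (∀ᶠ u in G.germ x h, u.toReal < τ) := fun H => by
    filter_upwards [H, hI] with u hu hu'
    exact (ENNReal.lt_ofReal_iff_toReal_lt hu'.2.ne_top).1 hu
  have hgt : (∀ᶠ u in G.germ x h, ENNReal.ofReal τ < u) →
      (∀ᶠ u in G.germ x h, τ < u.toReal) := fun H => by
    filter_upwards [H, hI] with u hu hu'
    exact (ENNReal.ofReal_lt_iff_lt_toReal hτ hu'.2.ne_top).1 hu
  rcases lt_trichotomy (G.startParam x h) (ENNReal.ofReal τ) with hs | hs | hs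
  · exact Or.inl (hlt (germ_le_nhds _ _ (Iio_mem_nhds hs)))
  · obtain ⟨e, d⟩ := h
    cases d
    · refine Or.inl (hlt ?_)
      rw [germ_false, ← hs]
      exact self_mem_nhdsWithin
    · refine Or.inr (hgt ?_)
      rw [germ_true, ← hs]
      exact self_mem_nhdsWithin
  · exact Or.inr (hgt (germ_le_nhds _ _ (Ioi_mem_nhds hs)))

/-- A nonconstant affine function changes sign only at its root, and a germ eventually stays on one
side of any given parameter. This makes pairs of affine germs comparable. -/
theorem eventually_germ_sign (hh : G.IsHalfEdgeAt x h) (c n : ℝ) :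
    (∀ᶠ u in G.germ x h, c + n * u.toReal = 0) ∨ (∀ᶠ u in G.germ x h, 0 < c + n * u.toReal) ∨
      (∀ᶠ u in G.germ x h, c + n * u.toReal < 0) := by
  rcases lt_trichotomy n 0 with hn | rfl | hn
  · have key : ∀ r : ℝ, c + n * r = n * (r - -c / n) := fun r => by
      rw [mul_sub, mul_div_cancel₀ _ hn.ne]
      ring
    simp only [key]
    rcases eventually_germ_lt_or_gt hh (-c / n) with H | H
    · exact Or.inr (Or.inl (H.mono fun u hu => mul_pos_of_neg_of_neg hn (sub_neg.2 hu)))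
    · exact Or.inr (Or.inr (H.mono fun u hu => mul_neg_of_neg_of_pos hn (sub_pos.2 hu)))
  · simp only [zero_mul, add_zero]
    rcases lt_trichotomy c 0 with hc | hc | hc
    · exact Or.inr (Or.inr (Eventually.of_forall fun _ => hc))
    · exact Or.inl (Eventually.of_forall fun _ => hc)
    · exact Or.inr (Or.inl (Eventually.of_forall fun _ => hc))
  · have key : ∀ r : ℝ, c + n * r = n * (r - -c / n) := fun r => by
      rw [mul_sub, mul_div_cancel₀ _ hn.ne']
      ring
    simp only [key]
    rcases eventually_germ_lt_or_gt hh (-c / n) with H | H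
    · exact Or.inr (Or.inr (H.mono fun u hu => mul_neg_of_pos_of_neg hn (sub_neg.2 hu)))
    · exact Or.inr (Or.inl (H.mono fun u hu => mul_pos hn (sub_pos.2 hu)))

theorem exists_hasOutSlope_iff {f : G.Curve → EReal} :
    (∃ s, G.HasOutSlope f x h s) ↔ ∃ (n : ℤ) (c : ℝ), ∀ᶠ u in G.germ x h,
      f (G.point h.1 u) = ((c + n * u.toReal : ℝ) : EReal) := by
  obtain ⟨e, d⟩ := h
  cases d
  · constructor
    · rintro ⟨s, c, hc⟩
      exact ⟨-s, c, by simpa using hc⟩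
    · rintro ⟨n, c, hc⟩
      exact ⟨-n, c, by simpa using hc⟩
  · constructor
    · rintro ⟨s, c, hc⟩
      exact ⟨s, c, by simpa using hc⟩
    · rintro ⟨n, c, hc⟩
      exact ⟨n, c, by simpa using hc⟩

theorem hasOutSlope_outSlope {f : G.Curve → EReal} (hex : ∃ s, G.HasOutSlope f x h s) :
    G.HasOutSlope f x h (G.outSlope f x h) := by
  rw [outSlope, dif_pos hex]
  exact hex.choose_spec

theorem IsPiecewiseLinear.exists_hasOutSlope {f : G.Curve → EReal} (hf : G.IsPiecewiseLinear f)
    (hh : G.IsHalfEdgeAt x h) : ∃ s, G.HasOutSlope f x h s := by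
  obtain ⟨e, d⟩ := h
  obtain ⟨B, hB⟩ := hf.piecewise e
  have hev : ∀ᶠ u in G.germ x (e, d), u ∉ B :=
    (germ_le_nhdsNE x (e, d)).trans (nhdsNE_le_cofinite _) B.finite_toSet.compl_mem_cofinite
  rw [exists_hasOutSlope_iff]
  cases d
  · rw [germ_false] at hev ⊢
    obtain ⟨a, ha, hsub⟩ := (mem_nhdsLT_iff_exists_Ioo_subset' (startParam_pos hh)).1 hev
    obtain ⟨n, c, hnc⟩ := hB a _ (startParam_le_len hh) fun u hu hu' => hsub hu' hu
    exact ⟨n, c, by filter_upwards [Ioo_mem_nhdsLT ha] with u hu using hnc u hu⟩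
  · rw [germ_true] at hev ⊢
    obtain ⟨b, hb, hsub⟩ := (mem_nhdsGT_iff_exists_Ioo_subset' (startParam_lt_len hh)).1 hev
    obtain ⟨n, c, hnc⟩ := hB (G.startParam x (e, true)) (min b (G.len e)) (min_le_right _ _)
      fun u hu hu' => hsub ⟨hu'.1, hu'.2.trans_le (min_le_left _ _)⟩ hu
    refine ⟨n, c, ?_⟩
    filter_upwards [Ioo_mem_nhdsGT (lt_min hb (startParam_lt_len hh))] with u hu using hnc u hu

theorem IsPiecewiseLinear.hasOutSlope {f : G.Curve → EReal} (hf : G.IsPiecewiseLinear f)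
    (hh : G.IsHalfEdgeAt x h) : G.HasOutSlope f x h (G.outSlope f x h) :=
  hasOutSlope_outSlope (hf.exists_hasOutSlope hh)

/-- On a germ the difference of the two functions is affine in the parameter, so it vanishes
identically or nowhere near the start. Values at the starting point play no role, so points at
infinity are covered. -/
theorem IsPiecewiseLinear.isTame_setOf_eq {f g : G.Curve → EReal} (hf : G.IsPiecewiseLinear f)
    (hg : G.IsPiecewiseLinear g) : IsTame {y | f y = g y} := by
  intro x h hh
  obtain ⟨n, c, hf⟩ := exists_hasOutSlope_iff.1 (hf.exists_hasOutSlope hh)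
  obtain ⟨m, b, hg⟩ := exists_hasOutSlope_iff.1 (hg.exists_hasOutSlope hh)
  simp only [mem_ofPred_eq]
  have key : ∀ r : ℝ, c - b + (n - m) * r = (c + n * r) - (b + m * r) := fun r => by ring
  rcases eventually_germ_sign hh (c - b) (n - m) with H | H | H
  · refine Or.inl ?_
    filter_upwards [hf, hg, H] with u h1 h2 h3
    rw [key, sub_eq_zero] at h3
    rw [h1, h2, h3]
  · refine Or.inr ?_
    filter_upwards [hf, hg, H] with u h1 h2 h3
    rw [key, sub_pos] at h3
    rw [h1, h2, EReal.coe_eq_coe_iff]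
    exact h3.ne'
  · refine Or.inr ?_
    filter_upwards [hf, hg, H] with u h1 h2 h3
    rw [key, sub_neg] at h3
    rw [h1, h2, EReal.coe_eq_coe_iff]
    exact h3.ne

/-- The distance between the starting point of the half-edge `h` of `x` and the point with parameter
`u` on it. -/
noncomputable def germDist (x : G.Curve) (h : E × Bool) (u : ℝ≥0∞) : ℝ :=
  if h.2 then u.toReal - (G.startParam x h).toReal else (G.startParam x h).toReal - u.toReal

theorem startParam_ne_top (hh : G.IsHalfEdgeAt x h) (hx : ¬ G.AtInfinity x) :
    G.startParam x h ≠ ⊤ := by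
  intro htop
  have hlen : G.len h.1 = ⊤ := top_le_iff.1 (htop ▸ startParam_le_len hh)
  exact hx ⟨h.1, hlen, by rw [← htop, point_startParam hh]⟩

theorem eventually_germDist_pos (hh : G.IsHalfEdgeAt x h) (hx : ¬ G.AtInfinity x) :
    ∀ᶠ u in G.germ x h, 0 < germDist x h u := by
  have hs := startParam_ne_top hh hx
  have hI := eventually_germ_mem_Ioo hh
  obtain ⟨e, d⟩ := h
  cases d
  · rw [germ_false] at hI ⊢
    filter_upwards [hI, self_mem_nhdsWithin] with u hu hu'
    simpa [germDist] using (ENNReal.toReal_lt_toReal hu.2.ne_top hs).2 hu'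
  · rw [germ_true] at hI ⊢
    filter_upwards [hI, self_mem_nhdsWithin] with u hu hu'
    simpa [germDist] using (ENNReal.toReal_lt_toReal hs hu.2.ne_top).2 hu'

/-- At a finite point, a continuous function with outgoing slope `s` grows linearly. -/
theorem HasOutSlope.eventually_eq {f : G.Curve → EReal} {s : ℤ} {a : ℝ}
    (hs : G.HasOutSlope f x h s) (hh : G.IsHalfEdgeAt x h) (hx : ¬ G.AtInfinity x)
    (hf : ContinuousAt f x) (ha : f x = a) :
    ∀ᶠ u in G.germ x h, f (G.point h.1 u) = ((a + s * germDist x h u : ℝ) : EReal) := by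
  obtain ⟨c, hc⟩ := hs
  have := germ_neBot hh
  have ht := startParam_ne_top hh hx
  set σ : ℝ := if h.2 then (s : ℝ) else -(s : ℝ) with hσ
  have h1 : Tendsto (fun u => f (G.point h.1 u)) (G.germ x h) (𝓝 (f x)) :=
    continuousAt_iff_germ.1 hf h hh
  have h2 : Tendsto (fun u : ℝ≥0∞ => ((c + σ * u.toReal : ℝ) : EReal)) (G.germ x h)
      (𝓝 ((c + σ * (G.startParam x h).toReal : ℝ) : EReal)) := by
    refine (continuous_coe_real_ereal.tendsto _).comp (Tendsto.const_add _ (Tendsto.const_mul _ ?_))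
    exact (ENNReal.tendsto_toReal ht).mono_left (germ_le_nhds x h)
  have h3 := tendsto_nhds_unique (h1.congr' hc) h2
  rw [ha, EReal.coe_eq_coe_iff] at h3
  filter_upwards [hc] with u hu
  rw [hu, EReal.coe_eq_coe_iff, h3, germDist]
  split_ifs at hσ ⊢ <;> rw [hσ] <;> ring

theorem HasOutSlope.le_of_eventually_le {f : G.Curve → EReal} {s t : ℤ} {a : ℝ}
    (hs : G.HasOutSlope f x h s) (hh : G.IsHalfEdgeAt x h) (hx : ¬ G.AtInfinity x)
    (hf : ContinuousAt f x) (ha : f x = a)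
    (hle : ∀ᶠ u in G.germ x h, f (G.point h.1 u) ≤ ((a + t * germDist x h u : ℝ) : EReal)) :
    s ≤ t := by
  have := germ_neBot hh
  obtain ⟨u, h1, h2, h3⟩ := ((hs.eventually_eq hh hx hf ha).and
    (hle.and (eventually_germDist_pos hh hx))).exists
  rw [h1, EReal.coe_le_coe_iff, add_le_add_iff_left] at h2
  exact_mod_cast le_of_mul_le_mul_right h2 h3

theorem HasOutSlope.lt_of_eventually_lt {f g : G.Curve → EReal} {s t : ℤ} {a : ℝ}
    (hs : G.HasOutSlope f x h s) (ht : G.HasOutSlope g x h t) (hh : G.IsHalfEdgeAt x h)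
    (hx : ¬ G.AtInfinity x) (hf : ContinuousAt f x) (hg : ContinuousAt g x) (hfa : f x = a)
    (hga : g x = a) (hlt : ∀ᶠ u in G.germ x h, f (G.point h.1 u) < g (G.point h.1 u)) :
    s < t := by
  have := germ_neBot hh
  obtain ⟨u, h1, h2, h3, h4⟩ := ((hs.eventually_eq hh hx hf hfa).and
    ((ht.eventually_eq hh hx hg hga).and (hlt.and (eventually_germDist_pos hh hx)))).exists
  rw [h1, h2, EReal.coe_lt_coe_iff, add_lt_add_iff_left] at h3
  exact_mod_cast lt_of_mul_lt_mul_right h3 h4.le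

end Germ

/-! ### Piecewise linearity is a local property -/

theorem eq_of_eventually_affine {t : ℝ≥0∞} {l : Filter ℝ≥0∞} [l.NeBot] (hl : l ≤ 𝓝[≠] t)
    {c c' n n' : ℝ} (hfin : ∀ᶠ u in l, u ≠ ⊤)
    (h : ∀ᶠ u in l, c + n * u.toReal = c' + n' * u.toReal) : n = n' ∧ c = c' := by
  suffices hn : n = n' by
    obtain ⟨u, hu⟩ := h.exists
    subst hn
    exact ⟨rfl, by simpa using hu⟩
  by_contra hne
  obtain ⟨u, hu, hu'⟩ := (h.and hfin).exists
  -- A filter of punctured neighbourhoods avoids any given point eventually, which provides a second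
  -- parameter where the affine functions agree.
  have hev : ∀ᶠ w in l, w ∉ ({ENNReal.ofReal u.toReal} : Set ℝ≥0∞) :=
    hl.trans (nhdsNE_le_cofinite _) (finite_singleton _).compl_mem_cofinite
  obtain ⟨w, hw, hw', hw''⟩ := (h.and (hfin.and hev)).exists
  have h0 : (n - n') * (u.toReal - w.toReal) = 0 := by linear_combination hu - hw
  rcases mul_eq_zero.1 h0 with h0 | h0
  · exact hne (sub_eq_zero.1 h0)
  · rw [sub_eq_zero] at h0
    rw [h0, ENNReal.ofReal_toReal hw'] at hw''
    exact hw'' rfl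

/-- A locally affine function on an open interval is affine. -/
theorem exists_affine_of_locally_affine {F : ℝ≥0∞ → EReal} {a b : ℝ≥0∞}
    (hF : ∀ t ∈ Ioo a b, ∃ (n : ℤ) (c : ℝ), ∀ᶠ u in 𝓝 t, F u = ((c + n * u.toReal : ℝ) : EReal)) :
    ∃ (n : ℤ) (c : ℝ), ∀ t ∈ Ioo a b, F t = ((c + n * t.toReal : ℝ) : EReal) := by
  rcases (Ioo a b).eq_empty_or_nonempty with hE | ⟨t₀, ht₀⟩
  · exact ⟨0, 0, by simp [hE]⟩
  obtain ⟨n, c, hnc⟩ := hF t₀ ht₀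
  refine ⟨n, c, fun t ht => ?_⟩
  -- The parameters near which the formula found at `t₀` holds form a relatively clopen subset of a
  -- connected interval.
  let U : Set ℝ≥0∞ := {t | ∀ᶠ u in 𝓝 t, F u = ((c + n * u.toReal : ℝ) : EReal)}
  have hU : IsOpen U := isOpen_iff_mem_nhds.2 fun t ht => eventually_eventually_nhds.2 ht
  have hsub : Ioo a b ⊆ U := by
    refine isPreconnected_Ioo.subset_of_closure_inter_subset hU ⟨t₀, ht₀, hnc⟩ ?_
    rintro t ⟨htU, ht⟩
    obtain ⟨m, d, hmd⟩ := hF t ht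
    have hev : ∀ᶠ u in 𝓝 t, (F u = ((d + m * u.toReal : ℝ) : EReal)) ∧ u ∈ Ioo a b :=
      hmd.and (Ioo_mem_nhds ht.1 ht.2)
    obtain ⟨w, hw, hwU⟩ := mem_closure_iff_nhds.1 htU _ (eventually_eventually_nhds.2 hev)
    have hw : ∀ᶠ u in 𝓝 w, (F u = ((d + m * u.toReal : ℝ) : EReal)) ∧ u ∈ Ioo a b := hw
    have hwI := hw.self_of_nhds.2
    have : (𝓝[>] w).NeBot := nhdsGT_neBot_of_exists_gt ⟨_, hwI.2⟩
    obtain ⟨h1, h2⟩ := eq_of_eventually_affine (t := w) (l := 𝓝[>] w) (c := d) (c' := c) (n := m)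
      (n' := n) (nhdsWithin_mono _ fun _ h => ne_of_gt h)
      (by filter_upwards [nhdsWithin_le_nhds hw] with u hu using hu.2.2.ne_top)
      (by
        filter_upwards [nhdsWithin_le_nhds hw, nhdsWithin_le_nhds hwU] with u hu hu'
        exact EReal.coe_injective (hu.1.symm.trans hu'))
    rw [h1, h2] at hmd
    exact hmd
  exact (hsub ht).self_of_nhds

/-- Break points on an edge cannot accumulate, since both one-sided germs at an accumulation point
would be free of them. By compactness of `[0, len e]` there are finitely many. -/
theorem isPiecewiseLinear_of_exists_hasOutSlope {f : G.Curve → EReal} (hc : Continuous f)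
    (hfin : ∀ x, ¬ G.AtInfinity x → f x ≠ ⊥ ∧ f x ≠ ⊤)
    (hs : ∀ x h, G.IsHalfEdgeAt x h → ∃ s, G.HasOutSlope f x h s) : G.IsPiecewiseLinear f := by
  refine ⟨hc, hfin, fun e => ?_⟩
  let Q : Set ℝ≥0∞ := {t | ∃ (n : ℤ) (c : ℝ), ∀ᶠ u in 𝓝 t,
    f (G.point e u) = ((c + n * u.toReal : ℝ) : EReal)}
  have hQr : ∀ t < G.len e, ∀ᶠ u in 𝓝[>] t, u ∈ Q := fun t ht => by
    obtain ⟨h1, h2⟩ := isHalfEdgeAt_point_true ht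
    obtain ⟨n, c, hnc⟩ := exists_hasOutSlope_iff.1 (hs _ _ h1)
    have := eventually_eventually_germ hnc
    rw [germ_true, h2] at this
    exact this.mono fun u hu => ⟨n, c, hu⟩
  have hQl : ∀ t, 0 < t → t ≤ G.len e → ∀ᶠ u in 𝓝[<] t, u ∈ Q := fun t h0 ht => by
    obtain ⟨h1, h2⟩ := isHalfEdgeAt_point_false h0 ht
    obtain ⟨n, c, hnc⟩ := exists_hasOutSlope_iff.1 (hs _ _ h1)
    have := eventually_eventually_germ hnc
    rw [germ_false, h2] at this
    exact this.mono fun u hu => ⟨n, c, hu⟩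
  have hfinite : (Qᶜ ∩ Icc 0 (G.len e)).Finite := by
    by_contra hinf
    obtain ⟨t, ht, hacc⟩ := Set.Infinite.exists_accPt_of_subset_isCompact hinf isCompact_Icc
      inter_subset_right
    rw [accPt_iff_frequently_nhdsNE] at hacc
    refine hacc ?_
    rw [← nhdsLT_sup_nhdsGT]
    refine eventually_sup.2 ⟨?_, ?_⟩
    · rcases eq_zero_or_pos t with rfl | h0
      · simp
      · exact (hQl t h0 ht.2).mono fun u hu hu' => hu'.1 hu
    · rcases ht.2.eq_or_lt with rfl | hlt
      · filter_upwards [self_mem_nhdsWithin] with u hu hu'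
        exact hu'.2.2.not_gt hu
      · exact (hQr t hlt).mono fun u hu hu' => hu'.1 hu
  choose B hB using hfinite.exists_finset_coe
  refine ⟨B, fun a b hb hBab => exists_affine_of_locally_affine fun t ht => ?_⟩
  by_contra hcon
  have : t ∈ (B : Set ℝ≥0∞) := hB ▸ ⟨hcon, bot_le, ht.2.le.trans hb⟩
  exact hBab t this ht

open Classical in
theorem outDegree_eq_sum (S : Set G.Curve) (x : G.Curve) :
    (G.outDegree S x : ℤ) = ∑ h : E × Bool with G.IsHalfEdgeAt x h,
      if ∀ᶠ u in G.germ x h, G.point h.1 u ∉ S then 1 else 0 := by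
  rw [outDegree, ← Finset.filter_filter, Finset.card_filter]
  push_cast
  rfl

/-! ### From a smaller function to a subgraph that can fire -/

section Mem

variable {D : G.Curve →₀ ℤ} {f g : G.Curve → EReal}

theorem isPiecewiseLinear_of_mem_R (hf : f ∈ G.R D) : G.IsPiecewiseLinear f :=
  hf.1.resolve_left hf.2.1

theorem ord_add_nonneg_of_mem_R (hf : f ∈ G.R D) (x : G.Curve) : 0 ≤ D x + G.ord f x := by
  have := hf.2.2 x
  rwa [Finsupp.add_apply, div_apply G (isPiecewiseLinear_of_mem_R hf)] at this

theorem IsPiecewiseLinear.exists_real (hf : G.IsPiecewiseLinear f) {x : G.Curve}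
    (hx : ¬ G.AtInfinity x) : ∃ a : ℝ, f x = a := by
  obtain ⟨h1, h2⟩ := hf.finite_of_not_atInfinity x hx
  exact ⟨(f x).toReal, (EReal.coe_toReal h2 h1).symm⟩

/-- The locus where two rational functions `g ≤ f` agree fires from `f` towards `g`. -/
theorem ord_add_outDegree_le (hf : G.IsPiecewiseLinear f) (hg : G.IsPiecewiseLinear g)
    (hle : g ≤ f) {x : G.Curve} (hx : ¬ G.AtInfinity x) (hfg : f x = g x) :
    G.ord g x + G.outDegree {y | f y = g y} x ≤ G.ord f x := by
  obtain ⟨a, ha⟩ := hf.exists_real hx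
  rw [outDegree_eq_sum, ord, ord, ← Finset.sum_add_distrib]
  classical
  apply Finset.sum_le_sum
  intro h hh
  have hh : G.IsHalfEdgeAt x h := (Finset.mem_filter.1 hh).2
  split_ifs with hout
  -- Integrality turns the strict inequality of slopes into the gain of one chip per outgoing
  -- half-edge.
  · refine Int.add_one_le_iff.2 ((hg.hasOutSlope hh).lt_of_eventually_lt (hf.hasOutSlope hh) hh hx
      hg.continuous.continuousAt hf.continuous.continuousAt (hfg ▸ ha) ha ?_)
    exact hout.mono fun u hu => lt_of_le_of_ne (hle _) fun h => hu h.symm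
  · rw [add_zero]
    refine (hg.hasOutSlope hh).le_of_eventually_le hh hx hg.continuous.continuousAt (hfg ▸ ha) ?_
    filter_upwards [(hf.hasOutSlope hh).eventually_eq hh hx hf.continuous.continuousAt ha]
      with u hu
    exact hu ▸ hle _

theorem exists_canFire_of_le {K : Subgroup (G.Curve ≃ₜ G.Curve)} (hf : f ∈ G.RInv D K)
    (hg : g ∈ G.RInv D K) (hle : g ≤ f) (hne : f ≠ g) :
    G.IsSubgraph (closure (interior {y | f y = g y})) ∧
      closure (interior {y | f y = g y}) ≠ univ ∧
      G.IsInvariant K (closure (interior {y | f y = g y})) ∧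
      G.CanFire (closure (interior {y | f y = g y})) (D + G.div f) := by
  have hf' := isPiecewiseLinear_of_mem_R hf.1
  have hg' := isPiecewiseLinear_of_mem_R hg.1
  have hcl : IsClosed {y | f y = g y} := isClosed_eq hf'.continuous hg'.continuous
  have ht := hf'.isTame_setOf_eq hg'
  refine ⟨(ht.closure_interior hcl).isSubgraph isClosed_closure, fun huniv => hne ?_, ?_, ?_⟩
  · exact funext fun y => hcl.closure_interior_subset' (huniv.symm ▸ mem_univ y)
  · refine IsInvariant.closure_interior fun σ hσ => ?_
    have key : ∀ y, σ y ∈ {y | f y = g y} ↔ y ∈ {y | f y = g y} := fun y => by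
      simp only [mem_ofPred_eq]
      rw [← Function.comp_apply (f := f), ← Function.comp_apply (f := g), hf.2 σ hσ, hg.2 σ hσ]
    ext y
    refine ⟨?_, fun hy => ⟨σ.symm y, ?_, σ.apply_symm_apply y⟩⟩
    · rintro ⟨z, hz, rfl⟩
      exact (key z).2 hz
    · rw [← key, σ.apply_symm_apply]
      exact hy
  · intro x hx
    rw [isClosed_closure.frontier_eq] at hx
    -- Passing to the regular part is needed here: slopes of `f` and `g` can be compared only at
    -- boundary points where the common value is finite.
    have hxinf : ¬ G.AtInfinity x := fun hinf => hx.2 (interior_maximal subset_closure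
      isOpen_interior (ht.mem_interior_of_atInfinity hcl hx.1 hinf))
    rw [ht.outDegree_closure_interior hcl, Finsupp.add_apply, div_apply G hf']
    have h1 := ord_add_outDegree_le hf' hg' hle hxinf (hcl.closure_interior_subset' hx.1)
    have h2 := ord_add_nonneg_of_mem_R hg.1 x
    linarith

end Mem

/-! ### The distance to a closed set -/

/-- The path distance to a set. -/
noncomputable def setDist (S : Set G.Curve) (x : G.Curve) : ℝ≥0∞ := ⨅ y : S, G.pathDist y x

/-- The distance to a set, measured inside the edge `e`. -/
noncomputable def edgeDist (S : Set G.Curve) (e : E) (t : ℝ≥0∞) : ℝ≥0∞ :=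
  ⨅ s : {s // s ≤ G.len e ∧ G.point e s ∈ S}, ((s - t) + (t - s) : ℝ≥0∞)

/-- The distance within each edge between the set `S` and any end of the edge outside `S` is at
least `ε`. -/
def IsCollarWidth (S : Set G.Curve) (ε : ℝ≥0∞) : Prop :=
  ∀ e s, s ≤ G.len e → G.point e s ∈ S →
    (Curve.vertex (G.src e) ∉ S → ε ≤ s) ∧ (Curve.vertex (G.tgt e) ∉ S → ε ≤ G.len e - s)

variable {S : Set G.Curve} {ε : ℝ≥0∞}

theorem edgeDist_le {e : E} {s : ℝ≥0∞} (hs : s ≤ G.len e) (hsS : G.point e s ∈ S) (t : ℝ≥0∞) :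
    edgeDist S e t ≤ (s - t) + (t - s) :=
  iInf_le (fun s : {s // s ≤ G.len e ∧ G.point e s ∈ S} => ((s - t) + (t - s) : ℝ≥0∞)) ⟨s, hs, hsS⟩

theorem edgeDist_eq_zero {e : E} {t : ℝ≥0∞} (ht : t ≤ G.len e) (htS : G.point e t ∈ S) :
    edgeDist S e t = 0 := by
  simpa using edgeDist_le ht htS t

theorem edgeDist_le_add (S : Set G.Curve) (e : E) (t t' : ℝ≥0∞) :
    edgeDist S e t' ≤ edgeDist S e t + ((t - t') + (t' - t)) := by
  unfold edgeDist
  rw [ENNReal.iInf_add]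
  refine le_iInf fun s => (iInf_le _ s).trans ?_
  calc (s - t' + (t' - s) : ℝ≥0∞) ≤ (s - t + (t - t')) + (t' - t + (t - s)) :=
        add_le_add tsub_le_tsub_add_tsub tsub_le_tsub_add_tsub
    _ = _ := by ring

theorem IsCollarWidth.le_edgeDist (hε : IsCollarWidth S ε) {e : E} {t : ℝ≥0∞} (ht : t ≤ G.len e)
    {v : V} (hv : G.point e t = Curve.vertex v) (hvS : Curve.vertex v ∉ S) :
    ε ≤ edgeDist S e t := by
  refine le_iInf fun ⟨s, hs, hsS⟩ => ?_
  rcases eq_zero_or_pos t with rfl | h0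
  · rw [point_zero] at hv
    exact ((hε e s hs hsS).1 (hv ▸ hvS)).trans (by simp)
  · rcases ht.eq_or_lt with rfl | hlt
    · rw [point_of_len_le le_rfl] at hv
      exact ((hε e s hs hsS).2 (hv ▸ hvS)).trans le_add_self
    · rw [point_of_mem_Ioo h0 hlt] at hv
      simp at hv

/-- A vertex lies on several edges, with different distances to `S` inside them. Truncation at the
collar width makes all of them equal to `ε` (or to `0` on `S`), so the truncated distance is well
defined on the curve. -/
theorem IsCollarWidth.min_edgeDist_congr (hε : IsCollarWidth S ε) {e e' : E} {t t' : ℝ≥0∞}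
    (ht : t ≤ G.len e) (ht' : t' ≤ G.len e') (h : G.point e t = G.point e' t') :
    min ε (edgeDist S e t) = min ε (edgeDist S e' t') := by
  by_cases hS : G.point e t ∈ S
  · rw [edgeDist_eq_zero ht hS, edgeDist_eq_zero ht' (h ▸ hS)]
  · rcases hx : G.point e t with v | ⟨e₁, t₁, h0, h1⟩
    · rw [min_eq_left (hε.le_edgeDist ht hx (hx ▸ hS)),
        min_eq_left (hε.le_edgeDist ht' (h ▸ hx) (hx ▸ hS))]
    · rw [h] at hx
      have h2 := point_eq_inner_iff.1 hx
      rw [← h] at hx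
      have h3 := point_eq_inner_iff.1 hx
      rw [h2.1, h2.2, h3.1, h3.2]

/-- The truncated edge distance vanishes at the start of the path and grows along each segment by at
most the length of the segment. -/
theorem IsCollarWidth.min_edgeDist_le (hε : IsCollarWidth S ε) {y z : G.Curve} {r : ℝ≥0∞}
    (hy : y ∈ S) (h : G.PathLength y z r) {e : E} {t : ℝ≥0∞} (ht : t ≤ G.len e)
    (hz : z = G.point e t) : min ε (edgeDist S e t) ≤ r := by
  induction h generalizing e t with
  | refl => exact (min_le_right _ _).trans (edgeDist_eq_zero ht (hz ▸ hy)).le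
  | step y' z' r e' s' t' hs' ht' hy' hz' _ ih =>
    rw [hε.min_edgeDist_congr ht ht' (hz.symm.trans hz')]
    calc min ε (edgeDist S e' t') ≤ min ε (edgeDist S e' s' + ((s' - t') + (t' - s'))) :=
          min_le_min_left _ (edgeDist_le_add S e' s' t')
      _ ≤ min ε (edgeDist S e' s') + ((s' - t') + (t' - s')) := by
          rw [← min_add_add_right]
          exact min_le_min_right _ le_self_add
      _ ≤ _ := by gcongr; exact ih hs' hy'

theorem setDist_point_le (S : Set G.Curve) {e : E} {t : ℝ≥0∞} (ht : t ≤ G.len e) :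
    setDist S (G.point e t) ≤ edgeDist S e t := by
  refine le_iInf fun s => (iInf_le _ ⟨_, s.2.2⟩).trans (sInf_le ?_)
  simpa using PathLength.step _ _ _ e s t s.2.1 ht rfl rfl PathLength.refl

/-- Within the collar, the path distance to `S` can be computed inside the edges. -/
theorem IsCollarWidth.min_setDist_point (hε : IsCollarWidth S ε) {e : E} {t : ℝ≥0∞}
    (ht : t ≤ G.len e) : min ε (setDist S (G.point e t)) = min ε (edgeDist S e t) := by
  refine le_antisymm (min_le_min_left _ (setDist_point_le S ht)) (le_min (min_le_left _ _) ?_)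
  exact le_iInf fun y => le_sInf fun r hr => hε.min_edgeDist_le y.2 hr ht rfl

theorem setDist_eq_zero {x : G.Curve} (hx : x ∈ S) : setDist S x = 0 := by
  have h : G.pathDist x x ≤ 0 := sInf_le PathLength.refl
  exact nonpos_iff_eq_zero.1 ((iInf_le _ (⟨x, hx⟩ : S)).trans h)

/-- Covers a vertex that lies on no edge: only the trivial path ends there. -/
theorem setDist_eq_top {x : G.Curve} (hx : x ∉ S) (hiso : ∀ e t, t ≤ G.len e → x ≠ G.point e t) :
    setDist S x = ⊤ := by
  refine iInf_eq_top.2 fun y => sInf_eq_top.2 fun r hr => ?_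
  cases hr with
  | refl => exact (hx y.2).elim
  | step y' _ r e s t hs ht hy hz _ => exact (hiso e t ht hz).elim

theorem setDist_comp {K : Subgroup (G.Curve ≃ₜ G.Curve)} (hK : K ≤ G.isometryGroup)
    (hS : G.IsInvariant K S) {σ : G.Curve ≃ₜ G.Curve} (hσ : σ ∈ K) (x : G.Curve) :
    setDist S (σ x) = setDist S x := by
  have key : ∀ τ ∈ K, ∀ x, setDist S (τ x) ≤ setDist S x := fun τ hτ x => le_iInf fun y =>
    (iInf_le _ ⟨τ y, (hS τ hτ).subset ⟨y, y.2, rfl⟩⟩).trans (hK hτ y x).le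
  refine le_antisymm (key σ hσ x) ?_
  simpa using key σ⁻¹ (K.inv_mem hσ) (σ x)

/-- An end of an edge outside the closed set `S` has a neighbourhood in that edge missing `S`;
finitely many edges allow a common width. -/
theorem exists_isCollarWidth (hS : IsClosed S) : ∃ ε, 0 < ε ∧ ε ≠ ⊤ ∧ IsCollarWidth S ε := by
  have h : ∀ᶠ ε in 𝓝[>] (0 : ℝ≥0∞), ∀ e s, s ≤ G.len e → G.point e s ∈ S →
      (Curve.vertex (G.src e) ∉ S → ε ≤ s) ∧ (Curve.vertex (G.tgt e) ∉ S → ε ≤ G.len e - s) := by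
    refine eventually_all.2 fun e => ?_
    have hopen : IsOpen (G.point e ⁻¹' Sᶜ) := hS.isOpen_compl.preimage (continuous_point e)
    have h1 : ∀ᶠ ε in 𝓝[>] (0 : ℝ≥0∞), ∀ s ≤ G.len e, G.point e s ∈ S →
        Curve.vertex (G.src e) ∉ S → ε ≤ s := by
      by_cases hv : Curve.vertex (G.src e) ∈ S
      · exact Eventually.of_forall fun ε s _ _ h => (h hv).elim
      · obtain ⟨b, hb, hsub⟩ := (mem_nhdsGE_iff_exists_Ico_subset' (G.len_pos e)).1
          (mem_nhdsWithin_of_mem_nhds (hopen.mem_nhds (show (0 : ℝ≥0∞) ∈ _ by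
            rwa [mem_preimage, point_zero])))
        filter_upwards [Ioo_mem_nhdsGT hb] with ε hε s hs hsS _
        by_contra! hlt
        exact hsub ⟨bot_le, hlt.trans hε.2⟩ hsS
    have h2 : ∀ᶠ ε in 𝓝[>] (0 : ℝ≥0∞), ∀ s ≤ G.len e, G.point e s ∈ S →
        Curve.vertex (G.tgt e) ∉ S → ε ≤ G.len e - s := by
      by_cases hv : Curve.vertex (G.tgt e) ∈ S
      · exact Eventually.of_forall fun ε s _ _ h => (h hv).elim
      · obtain ⟨a, ha, hsub⟩ := (mem_nhdsLE_iff_exists_Ioc_subset' (G.len_pos e)).1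
          (mem_nhdsWithin_of_mem_nhds (hopen.mem_nhds (show G.len e ∈ _ by
            rwa [mem_preimage, point_of_len_le le_rfl])))
        filter_upwards [Ioo_mem_nhdsGT (tsub_pos_of_lt ha)] with ε hε s hs hsS _
        refine hε.2.le.trans (tsub_le_tsub_left ?_ _)
        by_contra! hlt
        exact hsub ⟨hlt, hs⟩ hsS
    filter_upwards [h1, h2] with ε h1 h2 s hs hsS using ⟨h1 s hs hsS, h2 s hs hsS⟩
  -- The bound by `1` only serves to make `ε` finite, so that the truncated distance is real-valued.
  obtain ⟨ε, h1, h2⟩ := (h.and (Ioo_mem_nhdsGT (zero_lt_one (α := ℝ≥0∞)))).exists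
  exact ⟨ε, h2.1, h2.2.ne_top, h1⟩

/-- The distance to `S` on an open interval of an edge avoiding `S`. -/
theorem exists_edgeDist_eq_min {e : E} {a b : ℝ≥0∞}
    (hab : ∀ u ∈ Ioo a b, G.point e u ∉ S) : ∃ p q : ℝ≥0∞, ∀ u ∈ Ioo a b,
      edgeDist S e u = min ((u - a) + p) ((b - u) + q) := by
  -- `p` and `q` are the distances from `a` and `b` to the parts of `S` on this edge below `a` and
  -- above `b`; they are `⊤` if there is no such part.
  refine ⟨⨅ s : {s // (s ≤ G.len e ∧ G.point e s ∈ S) ∧ s ≤ a}, a - s,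
    ⨅ s : {s // (s ≤ G.len e ∧ G.point e s ∈ S) ∧ b ≤ s}, s - b, fun u hu => ?_⟩
  rw [ENNReal.add_iInf, ENNReal.add_iInf]
  refine le_antisymm (le_min (le_iInf fun s => ?_) (le_iInf fun s => ?_)) (le_iInf fun s => ?_)
  · refine (edgeDist_le s.2.1.1 s.2.1.2 u).trans ?_
    rw [tsub_eq_zero_of_le (s.2.2.trans hu.1.le), zero_add, tsub_add_tsub_cancel hu.1.le s.2.2]
  · refine (edgeDist_le s.2.1.1 s.2.1.2 u).trans ?_
    rw [tsub_eq_zero_of_le (hu.2.le.trans s.2.2), add_zero, add_comm (b - u),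
      tsub_add_tsub_cancel s.2.2 hu.2.le]
  · rcases le_or_gt (s : ℝ≥0∞) a with hsa | hsa
    · refine (min_le_left _ _).trans ((iInf_le _ ⟨s, s.2, hsa⟩).trans ?_)
      rw [tsub_add_tsub_cancel hu.1.le hsa]
      exact le_add_self
    · have hbs : b ≤ s := not_lt.1 fun h => hab s ⟨hsa, h⟩ s.2.2
      refine (min_le_right _ _).trans ((iInf_le _ ⟨s, s.2, hbs⟩).trans ?_)
      rw [add_comm (b - u), tsub_add_tsub_cancel hbs hu.2.le]
      exact le_self_add

/-! ### The collar function -/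

section GermAffine

variable {x : G.Curve} {h : E × Bool}

/-- An extended nonnegative function of the parameter is eventually infinite, or eventually affine
with integer slope, along a half-edge. -/
def GermAffine (x : G.Curve) (h : E × Bool) (X : ℝ≥0∞ → ℝ≥0∞) : Prop :=
  (∀ᶠ u in G.germ x h, X u = ⊤) ∨ ∃ (n : ℤ) (c : ℝ), ∀ᶠ u in G.germ x h,
    X u ≠ ⊤ ∧ (X u).toReal = c + n * u.toReal

theorem germAffine_const (x : G.Curve) (h : E × Bool) (r : ℝ≥0∞) :
    GermAffine x h (fun _ => r) := by
  by_cases hr : r = ⊤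
  · exact Or.inl (Eventually.of_forall fun _ => hr)
  · exact Or.inr ⟨0, r.toReal, Eventually.of_forall fun _ => ⟨hr, by simp⟩⟩

theorem GermAffine.congr {X Y : ℝ≥0∞ → ℝ≥0∞} (hX : GermAffine x h X)
    (hXY : ∀ᶠ u in G.germ x h, X u = Y u) : GermAffine x h Y := by
  refine hX.imp (fun H => ?_) ?_
  · filter_upwards [H, hXY] with u h1 h2 using h2 ▸ h1
  · rintro ⟨n, c, H⟩
    exact ⟨n, c, by filter_upwards [H, hXY] with u h1 h2 using h2 ▸ h1⟩

theorem GermAffine.min {X Y : ℝ≥0∞ → ℝ≥0∞} (hh : G.IsHalfEdgeAt x h) (hX : GermAffine x h X)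
    (hY : GermAffine x h Y) : GermAffine x h (fun u => min (X u) (Y u)) := by
  by_cases hXt : ∀ᶠ u in G.germ x h, X u = ⊤
  · exact hY.congr (hXt.mono fun u hu => by rw [hu, min_top_left])
  by_cases hYt : ∀ᶠ u in G.germ x h, Y u = ⊤
  · exact hX.congr (hYt.mono fun u hu => by rw [hu, min_top_right])
  obtain ⟨n, c, hnc⟩ := hX.resolve_left hXt
  obtain ⟨m, d, hmd⟩ := hY.resolve_left hYt
  have hcmp : (∀ᶠ u in G.germ x h, X u ≤ Y u) ∨ (∀ᶠ u in G.germ x h, Y u ≤ X u) := by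
    have key : ∀ r : ℝ, (c - d) + (n - m) * r = (c + n * r) - (d + m * r) := fun r => by ring
    have hle : (∀ᶠ u in G.germ x h, (c - d) + ((n : ℝ) - m) * u.toReal ≤ 0) →
        ∀ᶠ u in G.germ x h, X u ≤ Y u := fun H => by
      filter_upwards [H, hnc, hmd] with u h1 h2 h3
      rwa [← ENNReal.toReal_le_toReal h2.1 h3.1, h2.2, h3.2, ← sub_nonpos, ← key]
    have hge : (∀ᶠ u in G.germ x h, 0 ≤ (c - d) + ((n : ℝ) - m) * u.toReal) →
        ∀ᶠ u in G.germ x h, Y u ≤ X u := fun H => by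
      filter_upwards [H, hnc, hmd] with u h1 h2 h3
      rwa [← ENNReal.toReal_le_toReal h3.1 h2.1, h2.2, h3.2, ← sub_nonneg, ← key]
    rcases eventually_germ_sign hh (c - d) (n - m) with H | H | H
    · exact Or.inl (hle (H.mono fun u hu => hu.le))
    · exact Or.inr (hge (H.mono fun u hu => hu.le))
    · exact Or.inl (hle (H.mono fun u hu => hu.le))
  rcases hcmp with H | H
  · exact hX.congr (H.mono fun u hu => (min_eq_left hu).symm)
  · exact hY.congr (H.mono fun u hu => (min_eq_right hu).symm)

theorem germAffine_sub_add {a b : ℝ≥0∞} (hI : ∀ᶠ u in G.germ x h, u ∈ Ioo a b) (p : ℝ≥0∞) :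
    GermAffine x h (fun u => (u - a) + p) := by
  by_cases hp : p = ⊤
  · exact Or.inl (Eventually.of_forall fun u => by simp [hp])
  refine Or.inr ⟨1, p.toReal - a.toReal, hI.mono fun u hu => ?_⟩
  have hu' : u - a ≠ ⊤ := (tsub_le_self.trans_lt (hu.2.trans_le le_top)).ne
  refine ⟨ENNReal.add_ne_top.2 ⟨hu', hp⟩, ?_⟩
  rw [ENNReal.toReal_add hu' hp, ENNReal.toReal_sub_of_le hu.1.le hu.2.ne_top]
  push_cast
  ring

theorem germAffine_sub_add' {a b : ℝ≥0∞} (hI : ∀ᶠ u in G.germ x h, u ∈ Ioo a b) (q : ℝ≥0∞) :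
    GermAffine x h (fun u => (b - u) + q) := by
  by_cases hq : q = ⊤
  · exact Or.inl (Eventually.of_forall fun u => by simp [hq])
  by_cases hb : b = ⊤
  · exact Or.inl (hI.mono fun u hu => by simp [hb, hu.2.ne_top])
  refine Or.inr ⟨-1, q.toReal + b.toReal, hI.mono fun u hu => ?_⟩
  have hu' : b - u ≠ ⊤ := (tsub_le_self.trans_lt (lt_top_iff_ne_top.2 hb)).ne
  refine ⟨ENNReal.add_ne_top.2 ⟨hu', hq⟩, ?_⟩
  rw [ENNReal.toReal_add hu' hq, ENNReal.toReal_sub_of_le hu.2.le hb]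
  push_cast
  ring

end GermAffine

/-- The distance to `S`, truncated at `ε`. -/
noncomputable def collarFn (S : Set G.Curve) (ε : ℝ≥0∞) (x : G.Curve) : ℝ :=
  (min ε (setDist S x)).toReal

variable {S : Set G.Curve} {ε : ℝ≥0∞} {x : G.Curve} {h : E × Bool}

theorem collarFn_nonneg (S : Set G.Curve) (ε : ℝ≥0∞) (x : G.Curve) : 0 ≤ collarFn S ε x :=
  ENNReal.toReal_nonneg

theorem collarFn_le (S : Set G.Curve) (hε : ε ≠ ⊤) (x : G.Curve) : collarFn S ε x ≤ ε.toReal :=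
  ENNReal.toReal_mono hε (min_le_left _ _)

theorem collarFn_of_mem (hx : x ∈ S) : collarFn S ε x = 0 := by
  simp [collarFn, setDist_eq_zero hx]

theorem IsCollarWidth.collarFn_point (hε : IsCollarWidth S ε) {e : E} {t : ℝ≥0∞}
    (ht : t ≤ G.len e) : collarFn S ε (G.point e t) = (min ε (edgeDist S e t)).toReal := by
  rw [collarFn, hε.min_setDist_point ht]

theorem IsCollarWidth.collarFn_vertex (hε : IsCollarWidth S ε) {v : V}
    (hv : Curve.vertex v ∉ S) : collarFn S ε (Curve.vertex v) = ε.toReal := by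
  by_cases hex : ∃ e t, t ≤ G.len e ∧ Curve.vertex v = G.point e t
  · obtain ⟨e, t, ht, hvt⟩ := hex
    rw [hvt, hε.collarFn_point ht, min_eq_left (hε.le_edgeDist ht hvt.symm hv)]
  · push Not at hex
    rw [collarFn, setDist_eq_top hv hex, min_top_right]

theorem exists_Ioo_subset_of_germ (hh : G.IsHalfEdgeAt x h) {p : ℝ≥0∞ → Prop}
    (hp : ∀ᶠ u in G.germ x h, p u) : ∃ a b, b ≤ G.len h.1 ∧ (∀ᶠ u in G.germ x h, u ∈ Ioo a b) ∧
      ∀ u ∈ Ioo a b, p u := by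
  have hp' := hp.and (eventually_germ_mem_Ioo hh)
  obtain ⟨e, d⟩ := h
  cases d
  · rw [germ_false] at hp' ⊢
    obtain ⟨a, ha, hsub⟩ := (mem_nhdsLT_iff_exists_Ioo_subset' (startParam_pos hh)).1 hp'
    exact ⟨a, _, startParam_le_len hh, Ioo_mem_nhdsLT ha, fun u hu => (hsub hu).1⟩
  · rw [germ_true] at hp' ⊢
    obtain ⟨b, hb, hsub⟩ := (mem_nhdsGT_iff_exists_Ioo_subset' (startParam_lt_len hh)).1 hp'
    exact ⟨_, b, le_of_forall_lt_imp_le_of_dense fun u hu => by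
        rcases lt_or_ge (G.startParam x (e, true)) u with h | h
        · exact (hsub ⟨h, hu⟩).2.2.le
        · exact h.trans (startParam_le_len hh),
      Ioo_mem_nhdsGT hb, fun u hu => (hsub hu).1⟩

/-- Inside `S` the collar function is zero; off `S` it is the minimum of the constant `ε` and two
distances of slope `1` and `-1`, either of which may be infinite. -/
theorem IsCollarWidth.exists_hasOutSlope (hε : IsCollarWidth S ε) (hεt : ε ≠ ⊤) (hS : IsTame S)
    (hh : G.IsHalfEdgeAt x h) : ∃ s, G.HasOutSlope (fun y => (collarFn S ε y : EReal)) x h s := by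
  rw [exists_hasOutSlope_iff]
  rcases hS x h hh with hin | hout
  · exact ⟨0, 0, hin.mono fun u hu => by simp [collarFn_of_mem hu]⟩
  obtain ⟨a, b, hb, hI, hab⟩ := exists_Ioo_subset_of_germ hh hout
  obtain ⟨p, q, hpq⟩ := exists_edgeDist_eq_min hab
  have hA : GermAffine x h (fun u => min ε (edgeDist S h.1 u)) :=
    ((germAffine_const x h ε).min hh ((germAffine_sub_add hI p).min hh
      (germAffine_sub_add' hI q))).congr (hI.mono fun u hu => by rw [hpq u hu])
  have := germ_neBot hh
  rcases hA with H | ⟨n, c, H⟩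
  · obtain ⟨u, hu⟩ := H.exists
    exact absurd ((min_le_left _ _).trans_lt (lt_top_iff_ne_top.2 hεt)) hu.not_lt
  · refine ⟨n, c, ?_⟩
    filter_upwards [H, hI] with u hu huI
    rw [hε.collarFn_point (huI.2.le.trans hb), hu.2]

/-- The collar function is locally constant at infinity. -/
theorem IsCollarWidth.eventually_eq_of_atInfinity (hε : IsCollarWidth S ε) (hεt : ε ≠ ⊤)
    (hS : IsClosed S) (hSinf : ∀ y ∈ S, G.AtInfinity y → y ∈ interior S)
    (hh : G.IsHalfEdgeAt x h) (hx : G.AtInfinity x) :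
    ∀ᶠ u in G.germ x h, collarFn S ε (G.point h.1 u) = collarFn S ε x := by
  by_cases hxS : x ∈ S
  · have hin : ∀ᶠ u in G.germ x h, G.point h.1 u ∈ S :=
      tendsto_point_germ hh (mem_interior_iff_mem_nhds.1 (hSinf x hxS hx))
    filter_upwards [hin] with u hu
    rw [collarFn_of_mem hxS, collarFn_of_mem hu]
  obtain ⟨e, he, rfl, heq⟩ := hx.exists_halfEdge
  obtain rfl := heq h hh
  have hpt := point_startParam hh
  have hst : G.startParam (Curve.vertex (G.tgt e)) (e, false) = ⊤ := by simp [startParam, he]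
  rw [hε.collarFn_vertex hxS]
  have hout : ∀ᶠ u in G.germ (Curve.vertex (G.tgt e)) (e, false), G.point e u ∉ S :=
    tendsto_point_germ hh (hS.isOpen_compl.mem_nhds hxS)
  rw [germ_false, hst] at hout ⊢
  obtain ⟨a, ha, hsub⟩ := (mem_nhdsLT_iff_exists_Ioo_subset' ENNReal.zero_lt_top).1 hout
  filter_upwards [Ioo_mem_nhdsLT (show a + ε < ⊤ from
    ENNReal.add_lt_top.2 ⟨ha, lt_top_iff_ne_top.2 hεt⟩)] with u hu
  rw [hε.collarFn_point (he ▸ le_top), min_eq_left]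
  refine le_iInf fun ⟨s, hs, hsS⟩ => ?_
  -- The infinite end is outside `S`, so `S` meets this edge only at parameters up to `a`; past `a +
  -- ε` the truncation is in force.
  have hsa : s ≤ a := by
    by_contra! hlt
    rcases eq_or_ne s ⊤ with rfl | hst'
    · rw [hst] at hpt
      exact hxS (hpt ▸ hsS)
    · exact hsub ⟨hlt, lt_top_iff_ne_top.2 hst'⟩ hsS
  calc ε ≤ u - a := ENNReal.le_sub_of_add_le_left ha.ne hu.1.le
    _ ≤ u - s := tsub_le_tsub_left hsa u
    _ ≤ _ := le_add_self

theorem toReal_tsub_add_tsub {s t : ℝ≥0∞} (hs : s ≠ ⊤) (ht : t ≠ ⊤) :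
    ((s - t) + (t - s)).toReal = |t.toReal - s.toReal| := by
  rcases le_total s t with h | h
  · rw [tsub_eq_zero_of_le h, zero_add, ENNReal.toReal_sub_of_le h ht, abs_of_nonneg]
    exact sub_nonneg.2 (ENNReal.toReal_mono ht h)
  · rw [tsub_eq_zero_of_le h, add_zero, ENNReal.toReal_sub_of_le h hs, abs_sub_comm, abs_of_nonneg]
    exact sub_nonneg.2 (ENNReal.toReal_mono hs h)

theorem IsCollarWidth.abs_sub_le (hε : IsCollarWidth S ε) (hεt : ε ≠ ⊤) {e : E} {s t : ℝ≥0∞}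
    (hs : s ≤ G.len e) (ht : t ≤ G.len e) (hs' : s ≠ ⊤) (ht' : t ≠ ⊤) :
    |collarFn S ε (G.point e t) - collarFn S ε (G.point e s)| ≤ |t.toReal - s.toReal| := by
  have key : ∀ {s t : ℝ≥0∞}, s ≤ G.len e → t ≤ G.len e → s ≠ ⊤ → t ≠ ⊤ →
      collarFn S ε (G.point e t) ≤ collarFn S ε (G.point e s) + |t.toReal - s.toReal| := by
    intro s t hs ht hs' ht'
    have hd : (s - t) + (t - s) ≠ ⊤ :=
      ENNReal.add_ne_top.2 ⟨(tsub_le_self.trans_lt (lt_top_iff_ne_top.2 hs')).ne,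
        (tsub_le_self.trans_lt (lt_top_iff_ne_top.2 ht')).ne⟩
    have hm : min ε (edgeDist S e s) ≠ ⊤ := ((min_le_left _ _).trans_lt
      (lt_top_iff_ne_top.2 hεt)).ne
    rw [hε.collarFn_point hs, hε.collarFn_point ht, ← toReal_tsub_add_tsub hs' ht',
      ← ENNReal.toReal_add hm hd]
    refine ENNReal.toReal_mono (ENNReal.add_ne_top.2 ⟨hm, hd⟩) ?_
    rw [← min_add_add_right]
    exact min_le_min le_self_add (edgeDist_le_add S e s t)
  rw [abs_sub_le_iff]
  constructor
  · linarith [key hs ht hs' ht']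
  · linarith [key ht hs ht' hs', abs_sub_comm t.toReal s.toReal]

/-- At finite points the function is 1-Lipschitz in the parameter. At infinity a Lipschitz bound
gives nothing, and local constancy replaces it. -/
theorem IsCollarWidth.continuous_collarFn (hε : IsCollarWidth S ε) (hεt : ε ≠ ⊤)
    (hS : IsClosed S) (hSinf : ∀ y ∈ S, G.AtInfinity y → y ∈ interior S) :
    Continuous (collarFn S ε) := by
  refine continuous_iff_continuousAt.2 fun x => continuousAt_iff_germ.2 fun h hh => ?_
  by_cases hx : G.AtInfinity x
  · exact tendsto_const_nhds.congr' ((hε.eventually_eq_of_atInfinity hεt hS hSinf hh hx).mono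
      fun u hu => hu.symm)
  have hs := startParam_ne_top hh hx
  rw [tendsto_iff_dist_tendsto_zero]
  have hlim : Tendsto (fun u : ℝ≥0∞ => |u.toReal - (G.startParam x h).toReal|) (G.germ x h)
      (𝓝 0) := by
    have h1 : Tendsto (fun u : ℝ≥0∞ => u.toReal) (G.germ x h) (𝓝 (G.startParam x h).toReal) :=
      (ENNReal.tendsto_toReal hs).mono_left (germ_le_nhds x h)
    exact tendsto_iff_dist_tendsto_zero.1 h1
  refine squeeze_zero' (Eventually.of_forall fun _ => dist_nonneg) ?_ hlim
  filter_upwards [eventually_germ_mem_Ioo hh] with u hu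
  have := hε.abs_sub_le hεt (startParam_le_len hh) hu.2.le hs hu.2.ne_top
  rwa [point_startParam hh] at this

/-! ### The orders of the collar function -/

section Collar

variable {S : Set G.Curve} {ε : ℝ≥0∞} {x : G.Curve} {h : E × Bool}

theorem outSlope_eq_zero_of_eventually_const {F : G.Curve → EReal} (hh : G.IsHalfEdgeAt x h)
    {r : ℝ} (hr : ∀ᶠ u in G.germ x h, F (G.point h.1 u) = r) : G.outSlope F x h = 0 :=
  HasOutSlope.outSlope_eq (startParam_ne hh) ⟨r, hr.mono fun u hu => by simp [hu]⟩

theorem IsCollarWidth.isPiecewiseLinear (hε : IsCollarWidth S ε) (hεt : ε ≠ ⊤)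
    (hcl : IsClosed S) (hS : IsTame S) (hSinf : ∀ y ∈ S, G.AtInfinity y → y ∈ interior S) :
    G.IsPiecewiseLinear (fun y => (collarFn S ε y : EReal)) :=
  isPiecewiseLinear_of_exists_hasOutSlope
    (continuous_coe_real_ereal.comp (hε.continuous_collarFn hεt hcl hSinf))
    (fun _ _ => ⟨EReal.coe_ne_bot _, EReal.coe_ne_top _⟩)
    fun _ _ hh => hε.exists_hasOutSlope hεt hS hh

/-- The slope is zero along half-edges that stay in `S`, and at most one along the others by the
Lipschitz bound. -/
theorem IsCollarWidth.ord_le_outDegree (hε : IsCollarWidth S ε) (hεt : ε ≠ ⊤)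
    (hcl : IsClosed S) (hS : IsTame S) (hSinf : ∀ y ∈ S, G.AtInfinity y → y ∈ interior S)
    (hx : x ∈ S) : G.ord (fun y => (collarFn S ε y : EReal)) x ≤ G.outDegree S x := by
  have hpl := hε.isPiecewiseLinear hεt hcl hS hSinf
  rw [outDegree_eq_sum, ord]
  classical
  apply Finset.sum_le_sum
  intro h hh
  have hh : G.IsHalfEdgeAt x h := (Finset.mem_filter.1 hh).2
  split_ifs with hout
  · have hxinf : ¬ G.AtInfinity x := fun hinf => by
      have hin : ∀ᶠ u in G.germ x h, G.point h.1 u ∈ S :=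
        tendsto_point_germ hh (mem_interior_iff_mem_nhds.1 (hSinf x hx hinf))
      have := germ_neBot hh
      obtain ⟨u, h1, h2⟩ := (hout.and hin).exists
      exact h1 h2
    refine (hpl.hasOutSlope hh).le_of_eventually_le hh hxinf hpl.continuous.continuousAt rfl ?_
    filter_upwards [eventually_germDist_pos hh hxinf, eventually_germ_mem_Ioo hh] with u hu huI
    have h1 := hε.abs_sub_le hεt (startParam_le_len hh) huI.2.le (startParam_ne_top hh hxinf)
      huI.2.ne_top
    rw [point_startParam hh] at h1
    have h2 : |u.toReal - (G.startParam x h).toReal| = germDist x h u := by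
      rw [← abs_of_pos hu, germDist]
      split_ifs
      · rfl
      · exact abs_sub_comm _ _
    rw [h2] at h1
    rw [EReal.coe_le_coe_iff]
    push_cast
    linarith [le_abs_self (collarFn S ε (G.point h.1 u) - collarFn S ε x)]
  · refine (outSlope_eq_zero_of_eventually_const hh (r := 0) ?_).le
    exact ((hS x h hh).resolve_right hout).mono fun u hu => by rw [collarFn_of_mem hu]

/-- Off `S` the function is, inside an edge, a minimum of affine functions of slopes `0`, `1` and
`-1`; the branch attaining the minimum at `t` is a supporting line from above. -/
theorem IsCollarWidth.exists_support_line (hε : IsCollarWidth S ε) (hεt : ε ≠ ⊤)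
    (hcl : IsClosed S) {e : E} {t : ℝ≥0∞} (h0 : 0 < t) (h1 : t < G.len e)
    (htS : G.point e t ∉ S) : ∃ d : ℤ, ∀ᶠ u in 𝓝 t,
      collarFn S ε (G.point e u) ≤ collarFn S ε (G.point e t) + d * (u.toReal - t.toReal) := by
  obtain ⟨a, b, htab, hab, hab'⟩ := exists_Icc_subset_of_mem_Ioo
    ((hcl.isOpen_compl.preimage (continuous_point e)).mem_nhds htS) h0 h1
  obtain ⟨p, q, hpq⟩ := exists_edgeDist_eq_min (S := S) (e := e) (a := a) (b := b)
    fun u hu => hab (Ioo_subset_Icc_self hu)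
  have hval : ∀ u ∈ Ioo a b,
      collarFn S ε (G.point e u) = (min ε (min ((u - a) + p) ((b - u) + q))).toReal := fun u hu => by
    rw [hε.collarFn_point (hab' (Ioo_subset_Icc_self hu)).2.le, hpq u hu]
  have hb : b ≠ ⊤ := (hab' (right_mem_Icc.2 (htab.1.trans htab.2).le)).2.ne_top
  have hne : ∀ {u v w : ℝ≥0∞}, u ≠ ⊤ → w ≠ ⊤ → (u - v) + w ≠ ⊤ := fun hu hw =>
    ENNReal.add_ne_top.2 ⟨(tsub_le_self.trans_lt (lt_top_iff_ne_top.2 hu)).ne, hw⟩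
  have hnhds := Ioo_mem_nhds htab.1 htab.2
  rw [hval t htab]
  rcases le_or_gt ε (min ((t - a) + p) ((b - t) + q)) with hle | hlt
  · refine ⟨0, Eventually.of_forall fun u => ?_⟩
    rw [min_eq_left hle]
    simpa using collarFn_le S hεt _
  rw [min_eq_right hlt.le]
  rcases le_total ((t - a) + p) ((b - t) + q) with hle | hle
  · rw [min_eq_left hle] at hlt ⊢
    have hp : p ≠ ⊤ := (le_add_self.trans_lt hlt).ne_top
    refine ⟨1, mem_of_superset hnhds fun u hu => ?_⟩
    rw [mem_ofPred_eq, hval u hu]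
    refine (ENNReal.toReal_mono (hne hu.2.ne_top hp)
      ((min_le_right _ _).trans (min_le_left _ _))).trans_eq ?_
    have h2 : ∀ w ∈ Ioo a b, ((w - a) + p).toReal = w.toReal - a.toReal + p.toReal := fun w hw => by
      rw [ENNReal.toReal_add (tsub_le_self.trans_lt (hw.2.trans_le le_top)).ne hp,
        ENNReal.toReal_sub_of_le hw.1.le hw.2.ne_top]
    rw [h2 u hu, h2 t htab]
    push_cast
    ring
  · rw [min_eq_right hle] at hlt ⊢
    have hq : q ≠ ⊤ := (le_add_self.trans_lt hlt).ne_top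
    refine ⟨-1, mem_of_superset hnhds fun u hu => ?_⟩
    rw [mem_ofPred_eq, hval u hu]
    refine (ENNReal.toReal_mono (hne hb hq)
      ((min_le_right _ _).trans (min_le_right _ _))).trans_eq ?_
    have h2 : ∀ w ∈ Ioo a b, ((b - w) + q).toReal = b.toReal - w.toReal + q.toReal := fun w hw => by
      rw [ENNReal.toReal_add (tsub_le_self.trans_lt (lt_top_iff_ne_top.2 hb)).ne hq,
        ENNReal.toReal_sub_of_le hw.2.le hb]
    rw [h2 u hu, h2 t htab]
    push_cast
    ring

/-- At an inner point a supporting line of slope `d` bounds the two outgoing slopes by `d` and `-d`.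
A vertex off `S` is a maximum, with value `ε`, and at infinity the function is locally constant. -/
theorem IsCollarWidth.ord_nonpos (hε : IsCollarWidth S ε) (hεt : ε ≠ ⊤)
    (hcl : IsClosed S) (hS : IsTame S) (hSinf : ∀ y ∈ S, G.AtInfinity y → y ∈ interior S)
    (hx : x ∉ S) : G.ord (fun y => (collarFn S ε y : EReal)) x ≤ 0 := by
  classical
  have hpl := hε.isPiecewiseLinear hεt hcl hS hSinf
  by_cases hxinf : G.AtInfinity x
  · refine (Finset.sum_eq_zero fun h hh => ?_).le
    have hh : G.IsHalfEdgeAt x h := (Finset.mem_filter.1 hh).2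
    refine outSlope_eq_zero_of_eventually_const hh (r := collarFn S ε x) ?_
    exact (hε.eventually_eq_of_atInfinity hεt hcl hSinf hh hxinf).mono fun u hu => by rw [hu]
  have hslope : ∀ (h : E × Bool) (d : ℤ), G.IsHalfEdgeAt x h → (∀ᶠ u in G.germ x h,
      collarFn S ε (G.point h.1 u) ≤ collarFn S ε x + d * germDist x h u) →
      G.outSlope (fun y => (collarFn S ε y : EReal)) x h ≤ d := fun h d hh hd =>
    (hpl.hasOutSlope hh).le_of_eventually_le hh hxinf hpl.continuous.continuousAt rfl
      (hd.mono fun u hu => EReal.coe_le_coe_iff.2 hu)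
  rcases x with v | ⟨e, t, h0, h1⟩
  · refine Finset.sum_nonpos fun h hh => ?_
    have hh : G.IsHalfEdgeAt (Curve.vertex v) h := (Finset.mem_filter.1 hh).2
    refine hslope h 0 hh (Eventually.of_forall fun u => ?_)
    rw [hε.collarFn_vertex hx]
    simpa using collarFn_le S hεt _
  · have hpt : G.point e t = Curve.inner e t h0 h1 := point_of_mem_Ioo h0 h1
    obtain ⟨d, hd⟩ := hε.exists_support_line hεt hcl h0 h1 (hpt ▸ hx)
    rw [hpt] at hd
    have hp := hslope (e, true) d rfl (by
      filter_upwards [germ_le_nhds (Curve.inner e t h0 h1) (e, true) hd] with u hu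
      simpa [germDist, startParam] using hu)
    have hm := hslope (e, false) (-d) rfl (by
      filter_upwards [germ_le_nhds (Curve.inner e t h0 h1) (e, false) hd] with u hu
      have hu : collarFn S ε (G.point e u) ≤
        collarFn S ε (Curve.inner e t h0 h1) + d * (u.toReal - t.toReal) := hu
      simp only [germDist, startParam, Bool.false_eq_true, if_false]
      push_cast
      linarith)
    have hfil : (Finset.univ.filter fun h : E × Bool =>
        G.IsHalfEdgeAt (Curve.inner e t h0 h1) h) = {(e, true), (e, false)} := by
      ext ⟨e', d⟩
      have : G.IsHalfEdgeAt (Curve.inner e t h0 h1) (e', d) ↔ e' = e := Iff.rfl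
      cases d <;> simp [this]
    rw [ord]
    refine ((Finset.sum_congr (by convert hfil) fun _ _ => rfl).trans
      (Finset.sum_pair (by simp))).trans_le ?_
    linarith

/-- The firing condition is used on the frontier only: the out-degree vanishes in the interior, and
off `S` effectivity of `D` suffices. -/
theorem IsCollarWidth.ord_le_of_canFire (hε : IsCollarWidth S ε) (hεt : ε ≠ ⊤)
    (hcl : IsClosed S) (hS : IsTame S) (hSinf : ∀ y ∈ S, G.AtInfinity y → y ∈ interior S)
    {D : G.Curve →₀ ℤ} (hD : 0 ≤ D) (hfire : G.CanFire S D) (x : G.Curve) :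
    G.ord (fun y => (collarFn S ε y : EReal)) x ≤ D x := by
  by_cases hx : x ∈ S
  · refine (hε.ord_le_outDegree hεt hcl hS hSinf hx).trans ?_
    by_cases hxi : x ∈ interior S
    · refine le_of_eq_of_le ?_ (hD x)
      classical
      rw [Finsupp.coe_zero, Pi.zero_apply, outDegree, Nat.cast_eq_zero, Finset.card_eq_zero]
      refine Finset.filter_eq_empty_iff.2 fun h _ hh => ?_
      have hin : ∀ᶠ u in G.germ x h, G.point h.1 u ∈ S :=
        tendsto_point_germ hh.1 (mem_interior_iff_mem_nhds.1 hxi)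
      have := germ_neBot hh.1
      obtain ⟨u, h1, h2⟩ := (hh.2.and hin).exists
      exact h1 h2
    · exact hfire x (hcl.frontier_eq ▸ ⟨hx, hxi⟩)
  · exact (hε.ord_nonpos hεt hcl hS hSinf hx).trans (hD x)

end Collar

/-! ### Subtracting a real-valued rational function -/

section Sub

variable {f : G.Curve → EReal} {H : G.Curve → ℝ}

theorem IsPiecewiseLinear.hasOutSlope_sub (hf : G.IsPiecewiseLinear f)
    (hH : G.IsPiecewiseLinear (fun y => (H y : EReal))) {x : G.Curve} {h : E × Bool}
    (hh : G.IsHalfEdgeAt x h) : G.HasOutSlope (fun y => f y + ((-H y : ℝ) : EReal)) x h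
      (G.outSlope f x h - G.outSlope (fun y => (H y : EReal)) x h) := by
  obtain ⟨c, hc⟩ := hf.hasOutSlope hh
  obtain ⟨d, hd⟩ := hH.hasOutSlope hh
  refine ⟨c - d, ?_⟩
  filter_upwards [hc, hd] with u h1 h2
  rw [h1, EReal.coe_injective h2, ← EReal.coe_add, EReal.coe_eq_coe_iff]
  split_ifs <;> push_cast <;> ring

theorem IsPiecewiseLinear.sub (hf : G.IsPiecewiseLinear f)
    (hH : G.IsPiecewiseLinear (fun y => (H y : EReal))) :
    G.IsPiecewiseLinear (fun y => f y + ((-H y : ℝ) : EReal)) := by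
  refine isPiecewiseLinear_of_exists_hasOutSlope ?_ (fun x hx => ?_)
    fun x h hh => ⟨_, hf.hasOutSlope_sub hH hh⟩
  · refine continuous_iff_continuousAt.2 fun x => ?_
    have hneg : Continuous fun y => ((-H y : ℝ) : EReal) :=
      (continuous_neg.comp hH.continuous).congr fun y => (EReal.coe_neg _).symm
    -- `H` is real-valued, so no indeterminate sum of infinities arises where `f` is infinite.
    exact (EReal.continuousAt_add (Or.inr (EReal.coe_ne_bot _)) (Or.inr (EReal.coe_ne_top _))).comp
      (f := fun y => (f y, ((-H y : ℝ) : EReal))) (hf.continuous.prodMk hneg).continuousAt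
  · obtain ⟨a, ha⟩ := hf.exists_real hx
    rw [ha, ← EReal.coe_add]
    exact ⟨EReal.coe_ne_bot _, EReal.coe_ne_top _⟩

theorem IsPiecewiseLinear.ord_sub (hf : G.IsPiecewiseLinear f)
    (hH : G.IsPiecewiseLinear (fun y => (H y : EReal))) (x : G.Curve) :
    G.ord (fun y => f y + ((-H y : ℝ) : EReal)) x =
      G.ord f x - G.ord (fun y => (H y : EReal)) x := by
  classical
  rw [ord, ord, ord, ← Finset.sum_sub_distrib]
  refine Finset.sum_congr rfl fun h hh => ?_
  have hh : G.IsHalfEdgeAt x h := (Finset.mem_filter.1 hh).2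
  exact (hf.hasOutSlope_sub hH hh).outSlope_eq (startParam_ne hh)

end Sub

/-! ### Firing a subgraph -/

theorem AtInfinity.mem_closure {x : G.Curve} (hx : G.AtInfinity x) :
    x ∈ closure {y | ¬ G.AtInfinity y} := by
  obtain ⟨e, he, hxe⟩ := hx
  obtain ⟨hh, -⟩ := isHalfEdgeAt_point_false (G := G) (he ▸ ENNReal.zero_lt_top) he.ge
  rw [← hxe] at hh
  have := germ_neBot hh
  refine mem_closure_of_tendsto (tendsto_point_germ hh) ?_
  filter_upwards [eventually_germ_mem_Ioo hh] with u hu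
  rintro ⟨e', -, he'⟩
  rw [point_of_mem_Ioo hu.1 hu.2, point_of_len_le le_top] at he'
  simp at he'

theorem exists_finite_notMem {S : Set G.Curve} (hcl : IsClosed S) (hS : S ≠ univ) :
    ∃ x, ¬ G.AtInfinity x ∧ x ∉ S := by
  obtain ⟨x, hx⟩ := (ne_univ_iff_exists_notMem S).1 hS
  by_cases hinf : G.AtInfinity x
  · obtain ⟨y, h1, h2⟩ := mem_closure_iff_nhds.1 hinf.mem_closure _ (hcl.isOpen_compl.mem_nhds hx)
    exact ⟨y, h2, h1⟩
  · exact ⟨x, hinf, hx⟩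

theorem IsCollarWidth.collarFn_pos {S : Set G.Curve} {ε : ℝ≥0∞} (hε : IsCollarWidth S ε)
    (h0 : 0 < ε) (hεt : ε ≠ ⊤) (hcl : IsClosed S) {x : G.Curve} (hx : x ∉ S) :
    0 < collarFn S ε x := by
  rcases x with v | ⟨e, t, ht0, ht1⟩
  · rw [hε.collarFn_vertex hx]
    exact ENNReal.toReal_pos h0.ne' hεt
  · rw [← point_of_mem_Ioo ht0 ht1] at hx ⊢
    obtain ⟨a, b, htab, hab, -⟩ := exists_Icc_subset_of_mem_Ioo
      ((hcl.isOpen_compl.preimage (continuous_point e)).mem_nhds hx) ht0 ht1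
    obtain ⟨p, q, hpq⟩ := exists_edgeDist_eq_min (S := S) (e := e) (a := a) (b := b)
      fun u hu => hab (Ioo_subset_Icc_self hu)
    rw [hε.collarFn_point ht1.le, hpq t htab]
    refine ENNReal.toReal_pos (lt_min h0 (lt_min ?_ ?_)).ne'
      ((min_le_left _ _).trans_lt (lt_top_iff_ne_top.2 hεt)).ne
    · exact (tsub_pos_of_lt htab.1).trans_le le_self_add
    · exact (tsub_pos_of_lt htab.2).trans_le le_self_add

/-- Firing a subgraph that can fire yields a smaller function of the invariant linear system, which
agrees with the given one on the regular part of the subgraph. -/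
theorem exists_lt_of_canFire {D : G.Curve →₀ ℤ} {K : Subgroup (G.Curve ≃ₜ G.Curve)}
    (hK : K ≤ G.isometryGroup) {f : G.Curve → EReal} (hf : f ∈ G.RInv D K) {S : Set G.Curve}
    (hS : G.IsSubgraph S) (hne : S ≠ univ) (hinv : G.IsInvariant K S)
    (hfire : G.CanFire S (D + G.div f)) :
    ∃ g ∈ G.RInv D K, g ≤ f ∧ f ≠ g ∧ ∀ x ∈ closure (interior S), g x = f x := by
  have hcl : IsClosed S := hS.1.isClosed
  have htame := hS.isTame
  have hfire' := htame.canFire_closure_interior hcl hfire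
  have hsub := hcl.closure_interior_subset'
  have hne' : closure (interior S) ≠ univ := fun h => hne (univ_subset_iff.1 (h ▸ hsub))
  have hSinf : ∀ y ∈ closure (interior S), G.AtInfinity y → y ∈ interior (closure (interior S)) :=
    fun y hy hinf => interior_maximal subset_closure isOpen_interior
      (htame.mem_interior_of_atInfinity hcl hy hinf)
  have htame' := htame.closure_interior hcl
  obtain ⟨ε, h0, hεt, hε⟩ := exists_isCollarWidth (S := closure (interior S)) isClosed_closure
  have hf' := isPiecewiseLinear_of_mem_R hf.1
  have hH := hε.isPiecewiseLinear hεt isClosed_closure htame' hSinf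
  -- Strictness must be tested at a finite point: where `f` is infinite, subtracting the collar
  -- function changes nothing.
  obtain ⟨z, hzinf, hzS⟩ := exists_finite_notMem isClosed_closure hne'
  obtain ⟨a, ha⟩ := hf'.exists_real hzinf
  have hpl := hf'.sub hH
  refine ⟨fun y => f y + ((-collarFn (closure (interior S)) ε y : ℝ) : EReal),
    ⟨⟨Or.inr hpl, fun h => ?_, fun x => ?_⟩, fun σ hσ => ?_⟩, fun y => ?_, fun h => ?_,
    fun x hx => ?_⟩
  · exact (hpl.finite_of_not_atInfinity z hzinf).1 (congrFun h z)
  · rw [Finsupp.add_apply, div_apply G hpl, hf'.ord_sub hH]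
    have := hε.ord_le_of_canFire hεt isClosed_closure htame' hSinf hf.1.2.2 hfire' x
    rw [Finsupp.add_apply, div_apply G hf'] at this
    simp only [Finsupp.coe_zero, Pi.zero_apply]
    linarith
  · ext y
    have h1 : f (σ y) = f y := congrFun (hf.2 σ hσ) y
    simp only [Function.comp_apply, collarFn, setDist_comp hK hinv.closure_interior hσ, h1]
  · have h1 : ((-collarFn (closure (interior S)) ε y : ℝ) : EReal) ≤ 0 := by
      exact_mod_cast neg_nonpos.2 (collarFn_nonneg _ _ _)
    simpa using add_le_add_right h1 (f y)
  · have h1 := congrFun h z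
    simp only [ha] at h1
    rw [← EReal.coe_add, EReal.coe_eq_coe_iff] at h1
    have := hε.collarFn_pos h0 hεt isClosed_closure hzS
    linarith
  · simp [collarFn_of_mem hx]

end EdgeWeightedGraph

/-! ### The characterization of extremals -/

theorem mainTheorem5 {V E : Type*} [Fintype V] [Fintype E] (G : EdgeWeightedGraph V E)
    (D : G.Curve →₀ ℤ) (K : Subgroup (G.Curve ≃ₜ G.Curve)) (hK : K ≤ G.isometryGroup) [Finite K]
    (f : G.Curve → EReal) (hf : f ∈ G.RInv D K) :
    G.IsExtremal (G.RInv D K) f ↔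
      ¬ ∃ S₁ S₂ : Set G.Curve,
        (G.IsSubgraph S₁ ∧ S₁ ≠ Set.univ ∧ G.IsInvariant K S₁ ∧ G.CanFire S₁ (D + G.div f)) ∧
        (G.IsSubgraph S₂ ∧ S₂ ≠ Set.univ ∧ G.IsInvariant K S₂ ∧ G.CanFire S₂ (D + G.div f)) ∧
        S₁ ∪ S₂ = Set.univ := by
  constructor
  · rintro ⟨-, hext⟩ ⟨S₁, S₂, ⟨h1, h1', h1'', h1f⟩, ⟨h2, h2', h2'', h2f⟩, hun⟩
    obtain ⟨g₁, hg₁, hle₁, hne₁, heq₁⟩ :=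
      EdgeWeightedGraph.exists_lt_of_canFire hK hf h1 h1' h1'' h1f
    obtain ⟨g₂, hg₂, hle₂, hne₂, heq₂⟩ :=
      EdgeWeightedGraph.exists_lt_of_canFire hK hf h2 h2' h2'' h2f
    -- The fired functions agree with `f` on the regular parts only, and these still cover the
    -- curve.
    refine (hext g₁ hg₁ g₂ hg₂ (le_antisymm (fun x => ?_) (sup_le hle₁ hle₂))).elim hne₁ hne₂
    rcases (closure_interior_union_eq_univ h2.1.isClosed hun).symm.subset (mem_univ x) with hx | hx
    · exact (heq₁ x hx).symm.le.trans le_sup_left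
    · exact (heq₂ x hx).symm.le.trans le_sup_right
  · refine fun hno => ⟨hf, fun g₁ hg₁ g₂ hg₂ hsup => ?_⟩
    by_contra! hcon
    have hle₁ : g₁ ≤ f := hsup ▸ le_sup_left
    have hle₂ : g₂ ≤ f := hsup ▸ le_sup_right
    have hc₂ : IsClosed {y | f y = g₂ y} :=
      isClosed_eq (EdgeWeightedGraph.isPiecewiseLinear_of_mem_R hf.1).continuous
        (EdgeWeightedGraph.isPiecewiseLinear_of_mem_R hg₂.1).continuous
    -- At each point the larger of `g₁` and `g₂` equals `f`, so the two agreement loci cover the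
    -- curve, and so do their regular parts.
    refine hno ⟨_, _, EdgeWeightedGraph.exists_canFire_of_le hf hg₁ hle₁ hcon.1,
      EdgeWeightedGraph.exists_canFire_of_le hf hg₂ hle₂ hcon.2,
      closure_interior_union_eq_univ hc₂ (eq_univ_of_forall fun y => ?_)⟩
    have hy : f y = max (g₁ y) (g₂ y) := congrFun hsup y
    rcases le_total (g₁ y) (g₂ y) with h | h
    · exact Or.inr (hy.trans (max_eq_right h))
    · exact Or.inl (hy.trans (max_eq_left h))
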